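/- **Conventions.** Let $\Delta_n=\{0,1,\dots,n\}$. A *colored simplicial cell complex* of dimension at most $n$ is a finite simplicial cell complex $K$ (a finite complex of closed balls in which the faces of each cell form the face poset of a simplex) whose vertices are colored by $\Delta_n$ so that the vertices of each cell have distinct colors; its *facets* are its $n$-simplices. It is a *colored triangulation* of a PL manifold $M$ if $|K|$ is PL homeomorphic to $M$. A *simplicial map* $f:K\to L$ sends cells to cells in such a way that, for each cell $A$, the cells contained in $A$ are sent exactly onto the cells contained in $f(A)$ (colors need not be preserved, and cells may be collapsed). If $H_n(K;\mathbb Z)$ and $H_n(L;\mathbb Z)$ are infinite cyclic with chosen generators $a,b$, then $f$ has *degree* $d$ if $f_*(a)=d\,b$. A degree $d$ simplicial map $f:K_1\to K_2$ between colored triangulations of $M_1$ and $M_2$ is *minimal* if there is no degree $d$ simplicial map $K_1'\to K_2'$ between colored triangulations of $M_1$ and $M_2$ (for any choice of generators) such that $K_1'$ has fewer facets than $K_1$ or $K_2'$ has fewer facets than $K_2$. For an $(n+1)$-regular loopless multigraph $\Gamma$ with a proper edge-coloring by $\Delta_n$, let $K(\Gamma)$ be obtained by taking, for each vertex $v$,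 an $n$-simplex $\sigma(v)$ with vertices labeled by $\Delta_n$ and, for each edge of color $j$ between $u$ and $v$, gluing the faces of $\sigma(u)$ and $\sigma(v)$ opposite to the vertices labeled $j$ so that labels match. $\Gamma$ is a *gem* of $M$ if $|K(\Gamma)|$ is PL homeomorphic to $M$, and a *crystallization* of $M$ if, moreover, for each $j\in\Delta_n$ the subgraph formed by the edges of colors other than $j$ is connected. A map $g:V(\Gamma)\to V(\Gamma')$ such that the endpoints of each edge of color $i$ go to a single vertex or to two vertices joined by an edge of color $i$ induces a simplicial map $K(\Gamma)\to K(\Gamma')$. **Statement.** Let $n\ge 1$ and $d\in\mathbb Z$. Then there is a minimal degree $d$ simplicial self-map of $\mathbb S^n$. More precisely, put $k=\max\{|d|,1\}$. Let $\Gamma_k$ be the graph with the $2k$ vertices $v_1,\dots,v_{2k}$ in which $v_{2j-1}$ and $v_{2j}$ are joined by $n$ edges of the colors $0,\dots,n-1$, and $v_{2j}$ and $v_{2j+1}$ are joined by an edge of color $n$ ($1\le j\le k$, $v_{2k+1}=v_1$). Let $\Gamma'=\Gamma_1$ be the graph with two vertices $v^1,v^2$ joined by $n+1$ edges, one of each color.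 Then $\Gamma'$ is a crystallization of $\mathbb S^n$ and $\Gamma_k$ is a gem of $\mathbb S^n$. Orient $K(\Gamma_k)$ and $K(\Gamma')$ by the classes $\sum_j \bigl(\sigma(v_{2j-1})-\sigma(v_{2j})\bigr)$ and $\sigma(v^1)-\sigma(v^2)$, respectively, each simplex being oriented by the order of its labels. Then the map $g_d:V(\Gamma_k)\to V(\Gamma')$ given by * $v_{2j-1}\mapsto v^1,\ v_{2j}\mapsto v^2$ for all $j$, if $d>0$; * $v_{2j-1}\mapsto v^2,\ v_{2j}\mapsto v^1$ for all $j$, if $d<0$; * $v_i\mapsto v^1$ for all $i$, if $d=0$ induces a minimal degree $d$ simplicial map $K(\Gamma_k)\to K(\Gamma')$ from $\mathbb S^n$ to $\mathbb S^n$. -/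

import Mathlib

/-! ### Compact polyhedra and piecewise-linear homeomorphisms -/

/-- A compact polyhedron: a finite union of convex hulls of finite sets. -/
def IsCompactPolyhedron {E : Type*} [AddCommGroup E] [Module ℝ E] (P : Set E) : Prop :=
  ∃ S : Finset (Finset E), P = ⋃ s ∈ S, convexHull ℝ (s : Set E)

/-- `P` and `Q` are PL homeomorphic: there is a homeomorphism from `P` onto `Q` whose graph is a
compact polyhedron.  (Then `P` and `Q`, being linear projections of the graph, are compact
polyhedra as well.) -/
def PLHomeomorphic {E F : Type*} [AddCommGroup E] [Module ℝ E] [TopologicalSpace E]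
    [AddCommGroup F] [Module ℝ F] [TopologicalSpace F] (P : Set E) (Q : Set F) : Prop :=
  ∃ h : P ≃ₜ Q, IsCompactPolyhedron (Set.range fun x : P => ((x : E), (h x : F)))

/-- The standard PL sphere `𝕊ⁿ`: the boundary of the standard `(n+1)`-simplex. -/
def plSphere (n : ℕ) : Set (Fin (n + 2) → ℝ) :=
  {x | x ∈ stdSimplex ℝ (Fin (n + 2)) ∧ ∃ i, x i = 0}

/-! ### Colored simplicial cell complexes -/

/-- A finite simplicial cell complex whose vertices are properly colored by `{0, …, n}`,
given by its poset of (nonempty) closed cells.  `color A` is the set of colors of the vertices of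
the cell `A`.  The last two axioms say that `B ↦ color B` is an order isomorphism from the poset of
cells contained in `A` onto the poset of nonempty subsets of `color A`; so the former is
the poset of nonempty faces of a simplex with vertex set `color A`. -/
structure ColoredComplex (n : ℕ) where
  Face : Type
  [instFintype : Fintype Face]
  [instPartialOrder : PartialOrder Face]
  color : Face → Finset (Fin (n + 1))
  color_nonempty : ∀ A, (color A).Nonempty
  color_mono : ∀ A B, A ≤ B → color A ⊆ color B
  existsUnique_face : ∀ A (s : Finset (Fin (n + 1))), s.Nonempty → s ⊆ color A →
    ∃! B, B ≤ A ∧ color B = s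

attribute [instance] ColoredComplex.instFintype ColoredComplex.instPartialOrder

namespace ColoredComplex

variable {n : ℕ}

/-- The polyhedron `|K|`, realized through the barycentric subdivision of `K`:
the vertices of the subdivision are the cells of `K` (the cell `A` being placed at the basis vector
`e_A`), its simplices are the chains of cells, and a point is given by its barycentric coordinates
in the subdivision. -/
def realization (K : ColoredComplex n) : Set (K.Face → ℝ) :=
  {x | (∀ A, 0 ≤ x A) ∧ ∑ A, x A = 1 ∧ IsChain (· ≤ ·) {A | x A ≠ 0}}

/-- The facets of `K`: the `n`-simplices, i.e. the cells with all `n + 1` colors. -/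
abbrev Facet (K : ColoredComplex n) : Type := {A : K.Face // K.color A = Finset.univ}

/-- The number of facets. -/
def numFacets (K : ColoredComplex n) : ℕ := Fintype.card K.Facet

/-- The `(n-1)`-simplices of `K`. -/
abbrev Ridge (K : ColoredComplex n) : Type := {A : K.Face // (K.color A).card = n}

open Classical in
/-- The simplicial boundary operator `∂ : C_n(K; ℤ) → C_{n-1}(K; ℤ)`, where every simplex is oriented
by the increasing order of the colors of its vertices: the face of a facet `σ` that omits the vertex
of color `i` occurs in `∂ σ` with coefficient `(-1) ^ i`. -/
noncomputable def boundary (K : ColoredComplex n) : (K.Facet → ℤ) →ₗ[ℤ] (K.Ridge → ℤ) where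
  toFun a ρ := ∑ σ : K.Facet, ∑ i : Fin (n + 1),
    if ρ.1 ≤ σ.1 ∧ K.color ρ.1 = {i}ᶜ then (-1) ^ (i : ℕ) * a σ else 0
  map_add' a b := by
    funext ρ
    simp only [Pi.add_apply, ← Finset.sum_add_distrib]
    refine Finset.sum_congr rfl fun σ _ => Finset.sum_congr rfl fun i _ => ?_
    split_ifs <;> ring
  map_smul' c a := by
    funext ρ
    simp only [Pi.smul_apply, smul_eq_mul, RingHom.id_apply, Finset.mul_sum]
    refine Finset.sum_congr rfl fun σ _ => Finset.sum_congr rfl fun i _ => ?_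
    split_ifs <;> ring

/-- `H_n(K; ℤ)`.  Since `K` has no simplices of dimension `n + 1`, this is the group of `n`-cycles
of the simplicial chain complex. -/
noncomputable def topHomology (K : ColoredComplex n) : Submodule ℤ (K.Facet → ℤ) :=
  LinearMap.ker K.boundary

/-- `a` is a fundamental class of `K`: `H_n(K; ℤ)` is infinite cyclic with generator `a`. -/
def IsFundamentalClass (K : ColoredComplex n) (a : K.Facet → ℤ) : Prop :=
  a ≠ 0 ∧ K.topHomology = Submodule.span ℤ {a}

/-- A simplicial map of simplicial cell complexes: a map of cells that sends the cells contained in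
`A` exactly onto the cells contained in the image of `A`.  It need not respect the colors and may
collapse cells to cells of lower dimension. -/
structure SimplicialMap (K L : ColoredComplex n) where
  toFun : K.Face → L.Face
  image_Iic : ∀ A, toFun '' Set.Iic A = Set.Iic (toFun A)

namespace SimplicialMap

variable {K L : ColoredComplex n}

/-- `f` maps the vertices of the facet `σ` as the permutation `π` of the colors prescribes: the
vertex of color `i` goes to a vertex of color `π i`. -/
def ActsBy (f : SimplicialMap K L) (σ : K.Facet) (π : Equiv.Perm (Fin (n + 1))) : Prop :=
  ∀ (i : Fin (n + 1)) (B : K.Face), B ≤ σ.1 → K.color B = {i} → L.color (f.toFun B) = {π i}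

open Classical in
/-- `1` or `-1` if `f` maps the facet `σ` onto a facet preserving or reversing the orientations
given by the order of the colors, i.e. the sign of the permutation of the colors of the vertices;
`0` if `f` maps `σ` to a simplex of lower dimension. -/
noncomputable def facetSign (f : SimplicialMap K L) (σ : K.Facet) : ℤ :=
  if h : ∃ π, f.ActsBy σ π then ((Equiv.Perm.sign h.choose : ℤˣ) : ℤ) else 0

open Classical in
/-- The map `C_n(K; ℤ) → C_n(L; ℤ)` induced by `f` on simplicial `n`-chains. -/
noncomputable def pushforward (f : SimplicialMap K L) (a : K.Facet → ℤ) : L.Facet → ℤ :=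
  fun τ => ∑ σ : K.Facet, if f.toFun σ.1 = τ.1 then f.facetSign σ * a σ else 0

/-- `f` has degree `d` with respect to the fundamental classes `a` of `K` and `b` of `L`:
`f_* a = d · b` in `H_n(L; ℤ)`. -/
def HasDegree (f : SimplicialMap K L) (a : K.Facet → ℤ) (b : L.Facet → ℤ) (d : ℤ) : Prop :=
  K.IsFundamentalClass a ∧ L.IsFundamentalClass b ∧ f.pushforward a = d • b

/-- `f : K → L` is a minimal simplicial map of degree `d` from `M₁` to `M₂`: `K` and `L` are colored
triangulations of `M₁` and `M₂`, `f` has degree `d`, and for every degree `d` simplicial map between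
colored simplicial cell complexes triangulating `M₁` and `M₂` (with any choice of fundamental
classes) neither the source nor the target has fewer facets than `K` or `L`, respectively. -/
structure IsMinimalOfDegree {E₁ E₂ : Type*} [AddCommGroup E₁] [Module ℝ E₁] [TopologicalSpace E₁]
    [AddCommGroup E₂] [Module ℝ E₂] [TopologicalSpace E₂] (M₁ : Set E₁) (M₂ : Set E₂)
    (f : SimplicialMap K L) (a : K.Facet → ℤ) (b : L.Facet → ℤ) (d : ℤ) : Prop where
  source : PLHomeomorphic K.realization M₁
  target : PLHomeomorphic L.realization M₂
  hasDegree : f.HasDegree a b d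
  minimal : ∀ (K' L' : ColoredComplex n) (f' : SimplicialMap K' L')
    (a' : K'.Facet → ℤ) (b' : L'.Facet → ℤ),
    PLHomeomorphic K'.realization M₁ → PLHomeomorphic L'.realization M₂ → f'.HasDegree a' b' d →
      K.numFacets ≤ K'.numFacets ∧ L.numFacets ≤ L'.numFacets

end SimplicialMap

end ColoredComplex

/-! ### Colored graphs and the complexes they encode -/

/-- A finite `(n+1)`-regular properly edge-colored loopless multigraph with colors `{0, …, n}`:
for each color `i` the edges of color `i` form a perfect matching, and `nbr i v` is the vertex
joined to `v` by the edge of color `i`. -/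
structure ColoredGraph (n : ℕ) where
  V : Type
  [instFintype : Fintype V]
  nbr : Fin (n + 1) → V → V
  nbr_nbr : ∀ i v, nbr i (nbr i v) = v
  nbr_ne : ∀ i v, nbr i v ≠ v

attribute [instance] ColoredGraph.instFintype

namespace ColoredGraph

variable {n : ℕ}

/-- Being in the same component of the subgraph formed by the edges with colors outside `C`. -/
def component (Γ : ColoredGraph n) (C : Finset (Fin (n + 1))) : Setoid Γ.V :=
  Relation.EqvGen.setoid fun u v => ∃ j, j ∉ C ∧ Γ.nbr j u = v

theorem component_mono (Γ : ColoredGraph n) {C D : Finset (Fin (n + 1))} (h : C ⊆ D) {u v : Γ.V}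
    (huv : Γ.component D u v) : Γ.component C u v := by
  induction huv with
  | rel u v e =>
    obtain ⟨j, hj, e⟩ := e
    exact .rel _ _ ⟨j, fun hjC => hj (h hjC), e⟩
  | refl => exact (Γ.component C).refl _
  | symm _ _ _ ih => exact (Γ.component C).symm ih
  | trans _ _ _ _ _ ih₁ ih₂ => exact (Γ.component C).trans ih₁ ih₂

/-- The cells of `K(Γ)`.  Take an `n`-simplex `σ(v)` with vertices labeled by the colors for every
vertex `v` of `Γ`.  Gluing `σ(u)` to `σ(v)` along the faces opposite to the vertices labeled `j`,
for each edge of color `j` between `u` and `v`, identifies the face of `σ(u)` with label set `C`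
with the one of `σ(v)` whenever `j ∉ C`.  So the cells with label set `C` are the components of the
subgraph formed by the edges with colors outside `C`. -/
structure Cell (Γ : ColoredGraph n) where
  colors : Finset (Fin (n + 1))
  nonempty : colors.Nonempty
  comp : Quotient (Γ.component colors)

/-- The image in `K(Γ)` of the face of `σ(v)` with label set `C`. -/
def cell (Γ : ColoredGraph n) (C : Finset (Fin (n + 1))) (hC : C.Nonempty) (v : Γ.V) : Γ.Cell :=
  ⟨C, hC, Quotient.mk (Γ.component C) v⟩

theorem cell_eq_cell_iff (Γ : ColoredGraph n) {C D : Finset (Fin (n + 1))} {hC : C.Nonempty}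
    {hD : D.Nonempty} {u v : Γ.V} :
    Γ.cell C hC u = Γ.cell D hD v ↔ C = D ∧ Γ.component C u v := by
  constructor
  · intro h
    obtain rfl : C = D := congrArg Cell.colors h
    exact ⟨rfl, Quotient.exact (eq_of_heq (Cell.mk.inj h).2)⟩
  · rintro ⟨rfl, h⟩
    exact congrArg (Cell.mk C hC) (Quotient.sound h)

theorem exists_cell_eq (Γ : ColoredGraph n) (A : Γ.Cell) : ∃ v, Γ.cell A.colors A.nonempty v = A := by
  obtain ⟨C, hC, q⟩ := A
  obtain ⟨v, rfl⟩ := Quotient.exists_rep q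
  exact ⟨v, rfl⟩

theorem finite_cell (Γ : ColoredGraph n) : Finite Γ.Cell := by
  refine Finite.of_surjective
    (fun p : {C : Finset (Fin (n + 1)) // C.Nonempty} × Γ.V => Γ.cell p.1.1 p.1.2 p.2) fun A => ?_
  obtain ⟨v, hv⟩ := Γ.exists_cell_eq A
  exact ⟨(⟨A.colors, A.nonempty⟩, v), hv⟩

noncomputable instance (Γ : ColoredGraph n) : Fintype Γ.Cell :=
  @Fintype.ofFinite _ Γ.finite_cell

/-- `A ≤ B` if, for some `v`, the cells `A` and `B` are the images of two faces of `σ(v)`, the first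
contained in the second. -/
instance (Γ : ColoredGraph n) : PartialOrder Γ.Cell where
  le A B := A.colors ⊆ B.colors ∧
    ∃ v, Γ.cell A.colors A.nonempty v = A ∧ Γ.cell B.colors B.nonempty v = B
  le_refl A := by
    obtain ⟨v, hv⟩ := Γ.exists_cell_eq A
    exact ⟨subset_rfl, v, hv, hv⟩
  le_trans A B D := by
    rintro ⟨hAB, u, hu, hu'⟩ ⟨hBD, v, hv, hv'⟩
    refine ⟨hAB.trans hBD, v, Eq.trans ?_ hu, hv'⟩
    exact Γ.cell_eq_cell_iff.2
      ⟨rfl, Γ.component_mono hAB (Γ.cell_eq_cell_iff.1 (hv.trans hu'.symm)).2⟩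
  le_antisymm A B := by
    rintro ⟨hAB, u, hu, hu'⟩ ⟨hBA, -⟩
    rw [← hu, ← hu']
    exact Γ.cell_eq_cell_iff.2 ⟨hAB.antisymm hBA, (Γ.component _).refl u⟩

/-- The colored simplicial cell complex `K(Γ)` encoded by `Γ`. -/
noncomputable def toComplex (Γ : ColoredGraph n) : ColoredComplex n where
  Face := Γ.Cell
  color A := A.colors
  color_nonempty A := A.nonempty
  color_mono _ _ h := And.left h
  existsUnique_face A s hs hsA := by
    obtain ⟨v, hv⟩ := Γ.exists_cell_eq A
    refine ⟨Γ.cell s hs v, ⟨⟨hsA, v, rfl, hv⟩, rfl⟩, ?_⟩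
    rintro B ⟨⟨hBA, w, hw, hw'⟩, hB⟩
    refine hw.symm.trans (Γ.cell_eq_cell_iff.2 ⟨hB, ?_⟩)
    exact Γ.component_mono hBA (Γ.cell_eq_cell_iff.1 (hw'.trans hv.symm)).2

/-- `Γ` is a gem of (represents) `M`: the polyhedron `|K(Γ)|` is PL homeomorphic to `M`. -/
def IsGem {E : Type*} [AddCommGroup E] [Module ℝ E] [TopologicalSpace E]
    (Γ : ColoredGraph n) (M : Set E) : Prop :=
  PLHomeomorphic Γ.toComplex.realization M

/-- `Γ` is a crystallization of `M`: a gem of `M` such that for every color `j` the subgraph formed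
by the edges of the colors other than `j` is connected. -/
def IsCrystallization {E : Type*} [AddCommGroup E] [Module ℝ E] [TopologicalSpace E]
    (Γ : ColoredGraph n) (M : Set E) : Prop :=
  Γ.IsGem M ∧ Nonempty Γ.V ∧ ∀ (j : Fin (n + 1)) (u v : Γ.V), Γ.component {j} u v

/-- The `n`-chain of `K(Γ)` with coefficient `s v` at the facet `σ(v)`, where `s` is
a function (a choice of signs) on the vertices of `Γ`. -/
noncomputable def chainOfSigns (Γ : ColoredGraph n) (s : Γ.V → ℤ) : Γ.toComplex.Facet → ℤ :=
  fun σ => s (Γ.exists_cell_eq σ.1).choose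

/-- A map between the vertex sets such that the endpoints of an edge of color `i`
go to a single vertex or to two vertices that are joined by an edge of color `i`. -/
structure VertexMap (Γ Γ' : ColoredGraph n) where
  toFun : Γ.V → Γ'.V
  map_nbr : ∀ i v, toFun (Γ.nbr i v) = toFun v ∨ toFun (Γ.nbr i v) = Γ'.nbr i (toFun v)

namespace VertexMap

variable {Γ Γ' : ColoredGraph n}

theorem map_component (g : VertexMap Γ Γ') {C : Finset (Fin (n + 1))} {u v : Γ.V}
    (h : Γ.component C u v) : Γ'.component C (g.toFun u) (g.toFun v) := by
  induction h with
  | rel u v h =>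
    obtain ⟨j, hj, rfl⟩ := h
    rcases g.map_nbr j u with e | e
    · rw [e]
    · rw [e]; exact .rel _ _ ⟨j, hj, rfl⟩
  | refl => exact (Γ'.component C).refl _
  | symm _ _ _ ih => exact (Γ'.component C).symm ih
  | trans _ _ _ _ _ ih₁ ih₂ => exact (Γ'.component C).trans ih₁ ih₂

/-- The simplicial map `K(Γ) → K(Γ')` induced by `g`: it sends the face of `σ(v)` with label set `C`
to the face of `σ(g v)` with label set `C`. -/
def toSimplicialMap (g : VertexMap Γ Γ') :
    ColoredComplex.SimplicialMap Γ.toComplex Γ'.toComplex where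
  toFun A := ⟨A.colors, A.nonempty, Quotient.map g.toFun (fun _ _ h => g.map_component h) A.comp⟩
  image_Iic A := by
    ext B
    constructor
    · rintro ⟨D, ⟨hDA, v, hv, hv'⟩, rfl⟩
      refine ⟨hDA, g.toFun v, ?_, ?_⟩
      · rw [← hv]; rfl
      · rw [← hv']; rfl
    · rintro ⟨hBA, w, hw, hw'⟩
      obtain ⟨v, hv⟩ := Γ.exists_cell_eq A
      refine ⟨Γ.cell B.colors B.nonempty v, ⟨hBA, v, rfl, hv⟩, ?_⟩
      rw [← hv] at hw'
      have h := (Γ'.cell_eq_cell_iff.1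
        (hw' : Γ'.cell A.colors A.nonempty w = Γ'.cell A.colors A.nonempty (g.toFun v))).2
      refine Eq.trans ?_ hw
      exact Γ'.cell_eq_cell_iff.2 ⟨rfl, (Γ'.component _).symm (Γ'.component_mono hBA h)⟩

end VertexMap

/-! ### The graphs of the result -/

/-- The graph with `2 k` vertices `v_1, …, v_{2k}` in cyclic order, `v_{2j-1}` and `v_{2j}` being joined
by `n` edges of the colors `0, …, n-1` and `v_{2j}` and `v_{2j+1}` (`v_{2k}` and `v_1` for `j = k`) by
an edge of color `n`.  The vertex `v_{2j+1}` with `0 ≤ j < k` is written `(j, false)`, and `v_{2j+2}` is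
written `(j, true)`. -/
def sphereGem (n k : ℕ) [NeZero k] : ColoredGraph n where
  V := ZMod k × Bool
  nbr i v :=
    if i = Fin.last n then (if v.2 then (v.1 + 1, false) else (v.1 - 1, true)) else (v.1, !v.2)
  nbr_nbr i v := by
    obtain ⟨j, b⟩ := v
    cases b <;> by_cases h : i = Fin.last n <;> simp [h]
  nbr_ne i v := by
    obtain ⟨j, b⟩ := v
    cases b <;> by_cases h : i = Fin.last n <;> simp [h]

/-- The standard crystallization of `𝕊ⁿ`: two vertices `v¹ = (0, false)` and `v² = (0, true)`, joined by
`n + 1` edges, one of each color. -/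
abbrev standardCrystallization (n : ℕ) : ColoredGraph n := sphereGem n 1

/-- The signs of the vertices: `v_1, v_3, …` (respectively `v¹`) are positive and `v_2, v_4, …`
(respectively `v²`) are negative. -/
def sphereGemSign (n k : ℕ) [NeZero k] (v : (sphereGem n k).V) : ℤ :=
  if v.2 then -1 else 1

/-- The orientation of `K(sphereGem n k)`: the sum of the positive facets minus the sum of the
negative ones. -/
noncomputable def sphereGemClass (n k : ℕ) [NeZero k] : (sphereGem n k).toComplex.Facet → ℤ :=
  (sphereGem n k).chainOfSigns (sphereGemSign n k)

end ColoredGraph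

instance neZero_max_one (m : ℕ) : NeZero (max m 1) := ⟨by omega⟩

/-!
The simplex `σ(v)` of `K(sphereGem n k)` is the join of its axis, the boundary of the face with label
set `{0, …, n-1}`, with the path from the barycenter of that face (shared with one neighbor of `v`)
through the barycenter of `σ(v)` to the vertex of color `n` (shared with the other neighbor). The axis
is common to all the simplices, and the paths close up to a cycle of `4 k` points. In the same way the
boundary of the `(n+1)`-simplex is the join of the boundary of an `(n-1)`-face with the boundary of a
triangle. Placing the `4 k` points in cyclic order on the boundary of the triangle prescribes the
images of the barycenters of all cells; the linear map with these values restricts to a bijection of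
`|K(sphereGem n k)|` onto the sphere (`ColoredGraph.bijOn_sphereMap`), and a linear bijection of compact
polyhedra is a PL homeomorphism (`plHomeomorphic_of_bijOn`). Inverting it amounts to uniqueness and
existence of layer-cake decompositions (`eq_of_sum_mem_eq`, `exists_sum_mem_eq`) along the axis and of
hat-function coordinates (`IsCyclicPair.eq_of_sum_cyclePoint_eq`, `exists_cyclePoint_eq`) along the
cycle.

The degree of the folding map is a count, because induced maps preserve colors and hence
orientations (`ColoredGraph.hasDegree_foldMap`).

For minimality, let `f : K → L` have degree `d`. A nonzero cycle has at least two facets in its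
support, since every ridge in the boundary of a facet of the support lies in another one
(`ColoredComplex.exists_ne_of_mem_topHomology`); this gives the bound `2` for both complexes. If the
generator `a` of `H_n(K)` has coefficients in `{-1, 0, 1}`, then each of two facets of `L` in the support
of the generator has at least `|d|` preimages, and `K` has at least `2 |d|` facets. The coefficients of
`a` are bounded in this way as soon as every ridge lies in at most two facets: then the signs of the
coefficients of `a` form a cycle too, and `a` divides it
(`ColoredComplex.IsFundamentalClass.natAbs_le_one`).

That a ridge of a triangulated sphere lies in at most two facets is the only topological step
(`IsSphereGraph.not_three_pages`). The graph of a PL homeomorphism is a finite union of convex sets, on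
the cones over which the homogeneous extension of the homeomorphism is additive. By Baire's theorem,
near a generic point of the ridge this extension is linear on each of three given facets. In a flat
chart of the sphere the images of two of these facets lie on the same side of the image of the ridge,
so they overlap.
-/

/-! ### Compact polyhedra and linear maps -/

theorem IsCompactPolyhedron.image {E F : Type*} [AddCommGroup E] [Module ℝ E] [AddCommGroup F]
    [Module ℝ F] {P : Set E} (hP : IsCompactPolyhedron P) (f : E →ₗ[ℝ] F) :
    IsCompactPolyhedron (f '' P) := by
  classical
  obtain ⟨S, rfl⟩ := hP
  refine ⟨S.image fun s => s.image f, ?_⟩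
  rw [Set.image_iUnion₂, Finset.set_biUnion_finset_image]
  refine Set.iUnion₂_congr fun s _ => ?_
  rw [f.image_convexHull, Finset.coe_image]

theorem IsCompactPolyhedron.isCompact {E : Type*} [AddCommGroup E] [Module ℝ E] [TopologicalSpace E]
    [IsTopologicalAddGroup E] [ContinuousSMul ℝ E] {P : Set E} (hP : IsCompactPolyhedron P) :
    IsCompact P := by
  obtain ⟨S, rfl⟩ := hP
  exact S.isCompact_biUnion fun s _ => s.finite_toSet.isCompact_convexHull ℝ

/-- A continuous linear map that is injective on a compact polyhedron is a PL homeomorphism onto its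
image: the graph is a linear image of the polyhedron. -/
theorem plHomeomorphic_of_bijOn {E F : Type*} [AddCommGroup E] [Module ℝ E] [TopologicalSpace E]
    [IsTopologicalAddGroup E] [ContinuousSMul ℝ E] [AddCommGroup F] [Module ℝ F]
    [TopologicalSpace F] [T2Space F] {P : Set E} {Q : Set F} (hP : IsCompactPolyhedron P)
    (f : E →ₗ[ℝ] F) (hf : Continuous f) (h : Set.BijOn f P Q) : PLHomeomorphic P Q := by
  have : CompactSpace P := isCompact_iff_compactSpace.1 hP.isCompact
  let e : P ≃ Q := h.equiv f
  have he : Continuous e := (hf.comp continuous_subtype_val).subtype_mk _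
  refine ⟨he.homeoOfEquivCompactToT2, ?_⟩
  have := hP.image (LinearMap.id.prod f)
  convert this using 1
  ext x
  constructor
  · rintro ⟨y, rfl⟩
    exact ⟨y, y.2, rfl⟩
  · rintro ⟨y, hy, rfl⟩
    exact ⟨⟨y, hy⟩, rfl⟩

namespace ColoredComplex

variable {n : ℕ}

theorem isCompactPolyhedron_realization (K : ColoredComplex n) :
    IsCompactPolyhedron K.realization := by
  classical
  refine ⟨((Finset.univ : Finset (Finset K.Face)).filter
    fun s : Finset K.Face => IsChain (· ≤ ·) (s : Set K.Face)).image
      fun s : Finset K.Face => s.image fun A => (Pi.single A 1 : K.Face → ℝ), ?_⟩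
  rw [Finset.set_biUnion_finset_image]
  ext x
  simp only [Set.mem_iUnion, Finset.mem_filter, Finset.mem_univ, true_and, exists_prop]
  constructor
  · rintro ⟨h0, h1, hc⟩
    refine ⟨Finset.univ.filter fun A => x A ≠ 0, by simpa using hc, ?_⟩
    have hx : x = ∑ A ∈ Finset.univ.filter (fun A => x A ≠ 0),
        x A • (Pi.single A 1 : K.Face → ℝ) := by
      rw [Finset.sum_filter_of_ne]
      · funext B
        simp [Finset.sum_apply, Pi.single_apply]
      · rintro A - h h'
        simp [h'] at h
    suffices h : ∑ A ∈ Finset.univ.filter (fun A => x A ≠ 0), x A • (Pi.single A 1 : K.Face → ℝ) ∈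
        convexHull ℝ (((Finset.univ.filter fun A => x A ≠ 0).image fun A =>
          (Pi.single A 1 : K.Face → ℝ) : Finset (K.Face → ℝ)) : Set (K.Face → ℝ)) by
      rwa [← hx] at h
    refine (convex_convexHull ℝ _).sum_mem (fun A _ => h0 A) ?_ fun A hA => ?_
    · rw [Finset.sum_filter_of_ne (fun _ _ h => h), h1]
    · exact subset_convexHull ℝ _ (Finset.mem_coe.2 (Finset.mem_image_of_mem _ hA))
  · rintro ⟨s, hs, hx⟩
    have hconv : Convex ℝ {x : K.Face → ℝ | (∀ A, 0 ≤ x A) ∧ ∑ A, x A = 1 ∧ ∀ A ∉ s, x A = 0} := by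
      rintro x ⟨hx0, hx1, hxs⟩ y ⟨hy0, hy1, hys⟩ a b ha hb hab
      refine ⟨fun A => ?_, ?_, fun A hA => ?_⟩
      · exact add_nonneg (mul_nonneg ha (hx0 A)) (mul_nonneg hb (hy0 A))
      · simp [Finset.sum_add_distrib, ← Finset.mul_sum, hx1, hy1, hab]
      · simp [hxs A hA, hys A hA]
    have hsub : convexHull ℝ ((s.image fun A => (Pi.single A 1 : K.Face → ℝ) :
        Finset (K.Face → ℝ)) : Set (K.Face → ℝ)) ⊆ _ := convexHull_min (fun y hy => ?_) hconv
    · obtain ⟨h0, h1, h2⟩ := hsub hx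
      refine ⟨h0, h1, hs.mono fun A hA => ?_⟩
      by_contra hAs
      exact hA (h2 A hAs)
    · obtain ⟨A, hA, rfl⟩ := Finset.mem_image.1 (Finset.mem_coe.1 hy)
      refine ⟨fun B => ?_, by simp, fun B hB => ?_⟩
      · rw [Pi.single_apply]; split_ifs <;> norm_num
      · rw [Pi.single_eq_of_ne]
        rintro rfl
        exact hB hA

end ColoredComplex

/-! ### Layer-cake decompositions -/

section LayerCake

variable {ι : Type*} [DecidableEq ι]

/-- Among the members of a chain of finite sets that do not contain `C` there is a largest one; a
point of `C` outside of it lies only in those members that contain `C`. -/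
theorem exists_mem_forall_subset_of_isChain {T : Finset (Finset ι)}
    (hT : IsChain (· ⊆ ·) (T : Set (Finset ι))) {C : Finset ι} (hC : C.Nonempty) :
    ∃ i ∈ C, ∀ D ∈ T, i ∈ D → C ⊆ D := by
  by_cases hne : (T.filter fun D => ¬ C ⊆ D).Nonempty
  · obtain ⟨M, hM, hmax⟩ := Finset.exists_max_image _ Finset.card hne
    obtain ⟨hMT, hCM⟩ := Finset.mem_filter.1 hM
    obtain ⟨i, hiC, hiM⟩ := Finset.not_subset.1 hCM
    refine ⟨i, hiC, fun D hD hiD => ?_⟩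
    by_contra hCD
    have hcard := hmax D (Finset.mem_filter.2 ⟨hD, hCD⟩)
    rcases hT.total hD hMT with h | h
    · exact hiM (h hiD)
    · rw [Finset.eq_of_subset_of_card_le h hcard] at hiM
      exact hiM hiD
  · obtain ⟨i, hi⟩ := hC
    refine ⟨i, hi, fun D hD _ => ?_⟩
    by_contra hCD
    exact hne ⟨D, Finset.mem_filter.2 ⟨hD, hCD⟩⟩

variable [Fintype ι]

theorem sum_superset_le_of_sum_mem_eq {a b : Finset ι → ℝ} (ha : ∀ C, 0 ≤ a C)
    (hb : IsChain (· ⊆ ·) {C | b C ≠ 0})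
    (h : ∀ i, ∑ C with i ∈ C, a C = ∑ C with i ∈ C, b C) {C : Finset ι} (hC : C.Nonempty) :
    ∑ D with C ⊆ D, a D ≤ ∑ D with C ⊆ D, b D := by
  obtain ⟨i, hi, hiD⟩ := exists_mem_forall_subset_of_isChain
    (T := Finset.univ.filter fun D => b D ≠ 0) (by simpa using hb) hC
  have h1 : ∑ D with C ⊆ D, a D ≤ ∑ D with i ∈ D, a D :=
    Finset.sum_le_sum_of_subset_of_nonneg
      (Finset.monotone_filter_right _ fun D _ hD => hD hi) fun D _ _ => ha D
  refine h1.trans ((h i).trans ?_).le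
  refine (Finset.sum_subset (Finset.monotone_filter_right _ fun D _ hD => hD hi)
    fun D hD hD' => ?_).symm
  by_contra hne
  exact hD' (by simpa using hiD D (by simpa using hne) (by simpa using hD))

/-- Uniqueness of the layer-cake decomposition: a nonnegative function on a finite set is in at most
one way a nonnegative combination of indicators of a chain of nonempty subsets. -/
theorem eq_of_sum_mem_eq {a b : Finset ι → ℝ} (ha : ∀ C, 0 ≤ a C) (hb : ∀ C, 0 ≤ b C)
    (hac : IsChain (· ⊆ ·) {C | a C ≠ 0}) (hbc : IsChain (· ⊆ ·) {C | b C ≠ 0})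
    (h : ∀ i, ∑ C with i ∈ C, a C = ∑ C with i ∈ C, b C) (h0 : a ∅ = b ∅) : a = b := by
  funext C
  induction C using Finset.strongDownwardInduction (n := Fintype.card ι) with
  | H C ih =>
    rcases C.eq_empty_or_nonempty with rfl | hC
    · exact h0
    have key := (sum_superset_le_of_sum_mem_eq ha hbc h hC).antisymm
      (sum_superset_le_of_sum_mem_eq hb hac (fun i => (h i).symm) hC)
    have split : ∀ f : Finset ι → ℝ,
        ∑ D with C ⊆ D, f D = f C + ∑ D with C ⊂ D, f D := fun f => by
      rw [← Finset.sum_insert (by simp)]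
      refine Finset.sum_congr ?_ fun _ _ => rfl
      ext D
      simp only [Finset.mem_filter, Finset.mem_univ, true_and, Finset.mem_insert]
      rw [eq_comm]
      exact le_iff_eq_or_lt
    rw [split a, split b, Finset.sum_congr rfl fun D hD =>
      ih (D.card_le_univ) (Finset.mem_filter.1 hD).2] at key
    exact add_right_cancel key
  | _ => exact Finset.card_le_univ _

/-- Existence of the layer-cake decomposition of a nonnegative function on a finite set. -/
theorem exists_sum_mem_eq (w : ι → ℝ) (hw : ∀ i, 0 ≤ w i) :
    ∃ a : Finset ι → ℝ, (∀ C, 0 ≤ a C) ∧ a ∅ = 0 ∧ IsChain (· ⊆ ·) {C | a C ≠ 0} ∧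
      ∀ i, ∑ C with i ∈ C, a C = w i := by
  induction hm : (Finset.univ.filter fun i => w i ≠ 0).card using Nat.strong_induction_on
    generalizing w with
  | _ m ih =>
    set S := Finset.univ.filter fun i => w i ≠ 0 with hS
    have hwS : ∀ i ∉ S, w i = 0 := fun i hi => by simpa [hS] using hi
    rcases S.eq_empty_or_nonempty with h | h
    · refine ⟨0, fun _ => le_rfl, rfl, by simp [IsChain], fun i => ?_⟩
      rw [hwS i (by simp [h])]
      simp
    · obtain ⟨i₀, hi₀, hmin⟩ := Finset.exists_min_image S w h
      have hlt : (Finset.univ.filter fun i => (if i ∈ S then w i - w i₀ else 0) ≠ 0).card < m := by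
        rw [← hm]
        refine Finset.card_lt_card ⟨fun i hi => ?_, fun hsub => ?_⟩
        · by_contra hiS
          simp [hiS] at hi
        · have := hsub hi₀
          simp at this
      obtain ⟨a, ha0, hae, hac, has⟩ := ih _ hlt (fun i => if i ∈ S then w i - w i₀ else 0)
        (fun i => by
          split_ifs with hi
          · exact sub_nonneg.2 (hmin i hi)
          · exact le_rfl) rfl
      have hsub : ∀ C, a C ≠ 0 → C ⊆ S.erase i₀ := by
        intro C hC i hi
        have h1 : 0 < ∑ C with i ∈ C, a C :=
          Finset.sum_pos' (fun C _ => ha0 C) ⟨C, by simpa using hi, (ha0 C).lt_of_ne' hC⟩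
        rw [has i] at h1
        split_ifs at h1 with hiS
        · refine Finset.mem_erase.2 ⟨?_, hiS⟩
          rintro rfl
          simp at h1
        · exact absurd h1 (lt_irrefl _)
      have haS : a S = 0 := by
        by_contra hne
        simpa using hsub S hne hi₀
      refine ⟨Function.update a S (w i₀), fun C => ?_, ?_, ?_, fun i => ?_⟩
      · rw [Function.update_apply]
        split_ifs
        · exact hw i₀
        · exact ha0 C
      · rw [Function.update_of_ne h.ne_empty.symm, hae]
      · have hmono : {C | Function.update a S (w i₀) C ≠ 0} ⊆ insert S {C | a C ≠ 0} := by
          intro C hC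
          by_cases hCS : C = S
          · exact Or.inl hCS
          · change Function.update a S (w i₀) C ≠ 0 at hC
            rw [Function.update_of_ne hCS] at hC
            exact Or.inr hC
        refine IsChain.mono hmono (hac.insert fun C hC _ => Or.inr ?_)
        exact (hsub C hC).trans (Finset.erase_subset _ _)
      · have hupd : ∀ C, Function.update a S (w i₀) C = a C + if C = S then w i₀ else 0 := by
          intro C
          rw [Function.update_apply]
          split_ifs with hCS
          · rw [hCS, haS, zero_add]
          · rw [add_zero]
        simp only [hupd, Finset.sum_add_distrib, has, Finset.sum_ite_eq', Finset.mem_filter,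
          Finset.mem_univ, true_and]
        split_ifs with hi
        · ring
        · rw [hwS i hi, add_zero]

end LayerCake

/-! ### The cone over a subdivided triangle boundary -/

/-- The `i`-th of `N` points placed in cyclic order on the boundary of a triangle, in barycentric
coordinates: the vertex `0` is the first vertex of the triangle, and the vertices `1, …, N - 1`
subdivide the opposite edge into equal parts. -/
noncomputable def cyclePoint (N i : ℕ) : Fin 3 → ℝ :=
  if i = 0 then ![1, 0, 0] else ![0, ((N : ℝ) - 1 - i) / (N - 2), ((i : ℝ) - 1) / (N - 2)]

theorem cyclePoint_zero (N : ℕ) : cyclePoint N 0 = ![1, 0, 0] := if_pos rfl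

theorem cyclePoint_of_ne {N i : ℕ} (hi : i ≠ 0) :
    cyclePoint N i = ![0, ((N : ℝ) - 1 - i) / (N - 2), ((i : ℝ) - 1) / (N - 2)] := if_neg hi

theorem cyclePoint_nonneg {N i : ℕ} (hN : 3 ≤ N) (hi : i < N) (l : Fin 3) :
    0 ≤ cyclePoint N i l := by
  have hN' : (3 : ℝ) ≤ N := by exact_mod_cast hN
  have hi' : (i : ℝ) + 1 ≤ N := by exact_mod_cast hi
  rcases Nat.eq_zero_or_pos i with rfl | h
  · rw [cyclePoint_zero]
    fin_cases l <;> simp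
  · rw [cyclePoint_of_ne h.ne']
    have h' : (1 : ℝ) ≤ i := by exact_mod_cast h
    fin_cases l
    · exact le_rfl
    · exact div_nonneg (by linarith) (by linarith)
    · exact div_nonneg (by linarith) (by linarith)

theorem sum_cyclePoint {N : ℕ} (hN : 3 ≤ N) (i : ℕ) : ∑ l, cyclePoint N i l = 1 := by
  have hN' : (3 : ℝ) ≤ N := by exact_mod_cast hN
  have : (N : ℝ) - 2 ≠ 0 := by linarith
  by_cases h : i = 0
  · rw [h, cyclePoint_zero]
    simp [Fin.sum_univ_three]
  · rw [cyclePoint_of_ne h]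
    simp only [Fin.sum_univ_three, Matrix.cons_val_zero, Matrix.cons_val_one, Matrix.cons_val]
    field_simp
    ring

/-- `c` is supported on two cyclically adjacent points among `0, …, N - 1`. -/
def IsCyclicPair (N : ℕ) (c : ℕ → ℝ) : Prop :=
  ∃ i < N, ∀ m < N, c m ≠ 0 → m = i ∨ m = (i + 1) % N

theorem IsCyclicPair.exists_pair {N : ℕ} (hN : 3 ≤ N) {c : ℕ → ℝ} (hc : IsCyclicPair N c) :
    ∃ i, 1 ≤ i ∧ i + 1 < N ∧ ∀ m, 1 ≤ m → m < N → m ≠ i → m ≠ i + 1 → c m = 0 := by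
  obtain ⟨i, hi, h⟩ := hc
  rcases Nat.eq_zero_or_pos i with rfl | h0
  · refine ⟨1, le_rfl, by omega, fun m h1 hm h2 h3 => ?_⟩
    by_contra hne
    rcases h m hm hne with h' | h'
    · omega
    · rw [Nat.mod_eq_of_lt (by omega)] at h'
      omega
  by_cases hi' : i + 1 < N
  · refine ⟨i, h0, hi', fun m h1 hm h2 h3 => ?_⟩
    by_contra hne
    rcases h m hm hne with h' | h'
    · omega
    · rw [Nat.mod_eq_of_lt hi'] at h'
      omega
  · obtain rfl : N = i + 1 := by omega
    refine ⟨i - 1, by omega, by omega, fun m h1 hm h2 h3 => ?_⟩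
    by_contra hne
    rcases h m hm hne with h' | h'
    · omega
    · rw [Nat.mod_self] at h'
      omega

/-- The coefficients on the subdivided edge are values of hat functions: they depend only on the
total mass and on the first moment. -/
theorem IsCyclicPair.eq_max {N : ℕ} (hN : 3 ≤ N) {c : ℕ → ℝ} (h0 : ∀ m, 0 ≤ c m)
    (hc : IsCyclicPair N c) {m : ℕ} (hm : 1 ≤ m) (hmN : m < N) :
    c m = max 0 (∑ i ∈ Finset.Ico 1 N, c i -
      |∑ i ∈ Finset.Ico 1 N, i * c i - m * ∑ i ∈ Finset.Ico 1 N, c i|) := by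
  obtain ⟨i, hi1, hiN, h⟩ := hc.exists_pair hN
  have hsum : ∀ f : ℕ → ℝ, ∑ j ∈ Finset.Ico 1 N, f j * c j = f i * c i + f (i + 1) * c (i + 1) := by
    intro f
    have hsub : ({i, i + 1} : Finset ℕ) ⊆ Finset.Ico 1 N := by
      intro j hj
      rcases Finset.mem_insert.1 hj with rfl | hj
      · exact Finset.mem_Ico.2 ⟨hi1, by omega⟩
      · rw [Finset.mem_singleton.1 hj]
        exact Finset.mem_Ico.2 ⟨by omega, hiN⟩
    rw [← Finset.sum_subset hsub, Finset.sum_pair (by omega)]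
    intro j hj hj'
    obtain ⟨hj1, hj2⟩ := Finset.mem_Ico.1 hj
    simp only [Finset.mem_insert, Finset.mem_singleton, not_or] at hj'
    rw [h j hj1 hj2 hj'.1 hj'.2, mul_zero]
  have hT : ∑ j ∈ Finset.Ico 1 N, c j = c i + c (i + 1) := by simpa using hsum fun _ => 1
  have hS := hsum fun j => (j : ℝ)
  rw [hT, hS]
  have hi := h0 i
  have hi' := h0 (i + 1)
  push_cast
  rcases lt_trichotomy m i with hlt | rfl | hgt
  · have hle : (m : ℝ) + 1 ≤ i := by exact_mod_cast hlt
    rw [h m hm hmN (by omega) (by omega), max_eq_left]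
    have := le_abs_self (i * c i + (i + 1) * c (i + 1) - m * (c i + c (i + 1)))
    nlinarith [mul_nonneg (sub_nonneg.2 hle) (add_nonneg hi hi')]
  · rw [show (m * c m + (m + 1) * c (m + 1) - m * (c m + c (m + 1)) : ℝ) = c (m + 1) by ring,
      abs_of_nonneg hi', add_sub_cancel_right, max_eq_right hi]
  · rcases (show i + 1 ≤ m from hgt).eq_or_lt with rfl | hgt'
    · push_cast
      rw [show (i * c i + (i + 1) * c (i + 1) - (i + 1) * (c i + c (i + 1)) : ℝ) = - c i by ring,
        abs_neg, abs_of_nonneg hi, add_sub_cancel_left, max_eq_right hi']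
    · have hle : (i : ℝ) + 2 ≤ m := by exact_mod_cast hgt'
      rw [h m hm hmN (by omega) (by omega), max_eq_left]
      have := neg_abs_le (i * c i + (i + 1) * c (i + 1) - m * (c i + c (i + 1)))
      nlinarith [mul_nonneg (sub_nonneg.2 hle) (add_nonneg hi hi')]

/-- A nonnegative combination of two adjacent points of the cycle determines its coefficients. -/
theorem IsCyclicPair.eq_of_sum_cyclePoint_eq {N : ℕ} (hN : 3 ≤ N) {c c' : ℕ → ℝ}
    (h0 : ∀ m, 0 ≤ c m) (h0' : ∀ m, 0 ≤ c' m) (hc : IsCyclicPair N c) (hc' : IsCyclicPair N c')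
    (h : ∑ i ∈ Finset.range N, c i • cyclePoint N i = ∑ i ∈ Finset.range N, c' i • cyclePoint N i)
    {m : ℕ} (hm : m < N) : c m = c' m := by
  have hN' : (3 : ℝ) ≤ N := by exact_mod_cast hN
  have hN2 : (N : ℝ) - 2 ≠ 0 := by linarith
  have key : ∀ f : ℕ → ℝ, ∑ i ∈ Finset.range N, f i • cyclePoint N i =
      ![f 0, ∑ i ∈ Finset.Ico 1 N, f i * ((N - 1 - i) / (N - 2)),
        ∑ i ∈ Finset.Ico 1 N, f i * ((i - 1) / (N - 2))] := by
    intro f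
    have hf : ∀ i ∈ Finset.Ico 1 N, f i • cyclePoint N i =
        f i • ![0, ((N : ℝ) - 1 - i) / (N - 2), ((i : ℝ) - 1) / (N - 2)] := fun i hi => by
      rw [cyclePoint_of_ne (Nat.one_le_iff_ne_zero.1 (Finset.mem_Ico.1 hi).1)]
    rw [Finset.range_eq_Ico, Finset.sum_eq_sum_Ico_succ_bot (by omega), cyclePoint_zero, zero_add,
      Finset.sum_congr rfl hf]
    funext l
    fin_cases l <;> simp [Finset.sum_apply]
  rw [key, key] at h
  have hα : c 0 = c' 0 := congrFun h 0
  have hβ : ∑ i ∈ Finset.Ico 1 N, c i * ((N - 1 - i) / (N - 2)) =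
    ∑ i ∈ Finset.Ico 1 N, c' i * ((N - 1 - i) / (N - 2)) := congrFun h 1
  have hγ : ∑ i ∈ Finset.Ico 1 N, c i * ((i - 1) / (N - 2)) =
    ∑ i ∈ Finset.Ico 1 N, c' i * ((i - 1) / (N - 2)) := congrFun h 2
  have hT : ∑ i ∈ Finset.Ico 1 N, c i = ∑ i ∈ Finset.Ico 1 N, c' i := by
    have := congrArg₂ (· + ·) hβ hγ
    simp only [← Finset.sum_add_distrib] at this
    refine Eq.trans ?_ (this.trans ?_) <;> refine Finset.sum_congr rfl fun i _ => ?_ <;>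
      field_simp <;> ring
  have hS : ∑ i ∈ Finset.Ico 1 N, i * c i = ∑ i ∈ Finset.Ico 1 N, i * c' i := by
    have hid : ∀ f : ℕ → ℝ, ∑ i ∈ Finset.Ico 1 N, i * f i =
        (N - 2) * ∑ i ∈ Finset.Ico 1 N, f i * ((i - 1) / (N - 2)) +
          ∑ i ∈ Finset.Ico 1 N, f i := by
      intro f
      rw [Finset.mul_sum, ← Finset.sum_add_distrib]
      refine Finset.sum_congr rfl fun i _ => ?_
      field_simp
      ring
    rw [hid, hid, hγ, hT]
  rcases Nat.eq_zero_or_pos m with rfl | h1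
  · exact hα
  · rw [hc.eq_max hN h0 h1 hm, hc'.eq_max hN h0' h1 hm, hT, hS]

/-- Every point of the cone over the boundary of the triangle lies in the cone over an edge of the
cycle. -/
theorem exists_cyclePoint_eq {N : ℕ} (hN : 3 ≤ N) {x : Fin 3 → ℝ} (h0 : ∀ l, 0 ≤ x l)
    (hx : ∃ l, x l = 0) : ∃ i < N, ∃ s t : ℝ, 0 ≤ s ∧ 0 ≤ t ∧
      s • cyclePoint N i + t • cyclePoint N ((i + 1) % N) = x := by
  have hN' : (3 : ℝ) ≤ N := by exact_mod_cast hN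
  have hN2 : (N : ℝ) - 2 ≠ 0 := by linarith
  have hcast : ((N - 1 : ℕ) : ℝ) = N - 1 := by rw [Nat.cast_sub (by omega), Nat.cast_one]
  have hext : ∀ y : Fin 3 → ℝ, y 0 = x 0 → y 1 = x 1 → y 2 = x 2 → y = x := by
    intro y e0 e1 e2
    funext l
    fin_cases l
    exacts [e0, e1, e2]
  by_cases hα : x 0 = 0
  · rcases (add_nonneg (h0 1) (h0 2)).eq_or_lt with hT | hT
    · refine ⟨0, by omega, 0, 0, le_rfl, le_rfl, hext _ ?_ ?_ ?_⟩
      · simp [hα]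
      · simpa using (by linarith [h0 1, h0 2] : 0 = x 1)
      · simpa using (by linarith [h0 1, h0 2] : 0 = x 2)
    · -- the position of the point on the edge, in units of the mesh and counted from the vertex `1`
      set p : ℝ := (N - 2) * x 2 / (x 1 + x 2) with hp
      have hp0 : 0 ≤ p := div_nonneg (mul_nonneg (by linarith) (h0 2)) hT.le
      have hpN : p ≤ N - 2 := by
        rw [hp, div_le_iff₀ hT]
        exact mul_le_mul_of_nonneg_left (by linarith [h0 1]) (by linarith)
      have hpx : p * (x 1 + x 2) = (N - 2) * x 2 := by rw [hp]; field_simp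
      obtain ⟨i, hi1, hiN, hip, hip'⟩ : ∃ i : ℕ, 1 ≤ i ∧ i + 1 < N ∧ (i : ℝ) - 1 ≤ p ∧ p ≤ i := by
        by_cases h : p < N - 2
        · have hfl : ⌊p⌋₊ < N - 2 := by
            rw [Nat.floor_lt hp0, Nat.cast_sub (by omega)]
            exact_mod_cast h
          refine ⟨⌊p⌋₊ + 1, by omega, by omega, ?_, ?_⟩
          · simpa using Nat.floor_le hp0
          · simpa using (Nat.lt_floor_add_one p).le
        · refine ⟨N - 2, by omega, by omega, ?_, ?_⟩
          · rw [Nat.cast_sub (by omega)]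
            push_cast
            linarith
          · rw [Nat.cast_sub (by omega)]
            exact_mod_cast hpN
      refine ⟨i, by omega, (i - p) * (x 1 + x 2), (p - (i - 1)) * (x 1 + x 2),
        mul_nonneg (by linarith) hT.le, mul_nonneg (by linarith) hT.le, ?_⟩
      rw [Nat.mod_eq_of_lt hiN, cyclePoint_of_ne (i := i) (by omega),
        cyclePoint_of_ne (i := i + 1) (by omega)]
      refine hext _ ?_ ?_ ?_
      · simp [hα]
      · simp only [Pi.add_apply, Pi.smul_apply, smul_eq_mul, Matrix.cons_val_one, Matrix.cons_val_zero]
        push_cast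
        field_simp
        linear_combination (-1 : ℝ) * hpx
      · simp only [Pi.add_apply, Pi.smul_apply, smul_eq_mul, Matrix.cons_val]
        push_cast
        field_simp
        linear_combination hpx
  · by_cases hγ : x 2 = 0
    · refine ⟨0, by omega, x 0, x 1, h0 0, h0 1, ?_⟩
      rw [Nat.mod_eq_of_lt (by omega), cyclePoint_zero, cyclePoint_of_ne (i := 0 + 1) (by omega)]
      refine hext _ ?_ ?_ ?_
      · simp
      · have : ((N : ℝ) - 1 - 1) / (N - 2) = 1 := by rw [div_eq_one_iff_eq hN2]; ring
        simp [this]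
      · simp [hγ]
    · have hβ : x 1 = 0 := by
        obtain ⟨l, hl⟩ := hx
        fin_cases l
        exacts [absurd hl hα, hl, absurd hl hγ]
      refine ⟨N - 1, by omega, x 2, x 0, h0 2, h0 0, ?_⟩
      rw [Nat.sub_add_cancel (by omega), Nat.mod_self, cyclePoint_zero,
        cyclePoint_of_ne (i := N - 1) (by omega), hcast]
      refine hext _ ?_ ?_ ?_
      · simp
      · simp [hβ]
      · have : ((N : ℝ) - 1 - 1) / (N - 2) = 1 := by rw [div_eq_one_iff_eq hN2]; ring
        simp [this]

theorem IsCyclicPair.exists_sum_eq_zero {N : ℕ} (hN : 3 ≤ N) {c : ℕ → ℝ} (hc : IsCyclicPair N c) :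
    ∃ l, (∑ m ∈ Finset.range N, c m • cyclePoint N m) l = 0 := by
  obtain ⟨i, hi, h⟩ := hc
  have aux : ∀ l, cyclePoint N i l = 0 → cyclePoint N ((i + 1) % N) l = 0 →
      (∑ m ∈ Finset.range N, c m • cyclePoint N m) l = 0 := by
    intro l h1 h2
    rw [Finset.sum_apply]
    refine Finset.sum_eq_zero fun m hm => ?_
    by_cases hcm : c m = 0
    · simp [hcm]
    · rcases h m (Finset.mem_range.1 hm) hcm with rfl | rfl
      · simp [h1]
      · simp [h2]
  rcases Nat.eq_zero_or_pos i with rfl | h0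
  · refine ⟨2, aux 2 ?_ ?_⟩
    · simp [cyclePoint_zero]
    · rw [Nat.mod_eq_of_lt (by omega), cyclePoint_of_ne (i := 0 + 1) (by omega)]
      simp
  by_cases hi' : i + 1 < N
  · refine ⟨0, aux 0 ?_ ?_⟩
    · rw [cyclePoint_of_ne (by omega)]
      rfl
    · rw [Nat.mod_eq_of_lt hi', cyclePoint_of_ne (i := i + 1) (by omega)]
      rfl
  · obtain rfl : N = i + 1 := by omega
    refine ⟨1, aux 1 ?_ ?_⟩
    · rw [cyclePoint_of_ne (by omega)]
      simp
    · rw [Nat.mod_self, cyclePoint_zero]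
      rfl

/-! ### The polyhedron of a colored graph -/

namespace ColoredGraph

variable {n : ℕ}

theorem cell_eq_of_le {Γ : ColoredGraph n} {A B : Γ.Cell} (h : B ≤ A) {v : Γ.V}
    (hv : Γ.cell A.colors A.nonempty v = A) : Γ.cell B.colors B.nonempty v = B := by
  obtain ⟨hBA, w, hw, hw'⟩ := h
  refine Eq.trans (Γ.cell_eq_cell_iff.2 ⟨rfl, ?_⟩) hw
  exact Γ.component_mono hBA (Γ.cell_eq_cell_iff.1 (hv.trans hw'.symm)).2

open Classical in
/-- The point of `|K(Γ)|` in the simplex `σ(v)` whose coordinate at the barycenter of the face with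
label set `C` is `t C`. -/
noncomputable def facePoint (Γ : ColoredGraph n) (v : Γ.V) (t : Finset (Fin (n + 1)) → ℝ) :
    Γ.Cell → ℝ :=
  fun A => if Γ.cell A.colors A.nonempty v = A then t A.colors else 0

/-- The coordinates, in the barycentric subdivision, of the points of an `n`-simplex. -/
structure IsFlagPoint (t : Finset (Fin (n + 1)) → ℝ) : Prop where
  nonneg : ∀ C, 0 ≤ t C
  empty : t ∅ = 0
  sum_eq : ∑ C, t C = 1
  chain : IsChain (· ⊆ ·) {C | t C ≠ 0}

theorem sum_facePoint_smul {M : Type*} [AddCommGroup M] [Module ℝ M] (Γ : ColoredGraph n) (v : Γ.V)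
    {t : Finset (Fin (n + 1)) → ℝ} (ht : t ∅ = 0) (f : Γ.Cell → M)
    (g : Finset (Fin (n + 1)) → M) (hfg : ∀ C hC, f (Γ.cell C hC v) = g C) :
    ∑ A, Γ.facePoint v t A • f A = ∑ C, t C • g C := by
  classical
  have h1 : ∑ A, Γ.facePoint v t A • f A =
      ∑ A with Γ.cell A.colors A.nonempty v = A, t A.colors • f A := by
    rw [Finset.sum_filter]
    refine Finset.sum_congr rfl fun A _ => ?_
    rw [facePoint]
    split_ifs <;> simp
  rw [h1]
  refine Finset.sum_of_injOn Cell.colors ?_ (fun _ _ => Finset.mem_coe.2 (Finset.mem_univ _))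
    (fun C _ hC => ?_) fun A hA => ?_
  · intro A hA B hB hAB
    rw [← (Finset.mem_filter.1 (Finset.mem_coe.1 hA)).2,
      ← (Finset.mem_filter.1 (Finset.mem_coe.1 hB)).2]
    exact Γ.cell_eq_cell_iff.2 ⟨hAB, (Γ.component _).refl v⟩
  · rcases C.eq_empty_or_nonempty with rfl | hC'
    · rw [ht, zero_smul]
    · exact absurd ⟨Γ.cell C hC' v,
        Finset.mem_coe.2 (Finset.mem_filter.2 ⟨Finset.mem_univ _, rfl⟩), rfl⟩ hC
  · conv_lhs => rw [← (Finset.mem_filter.1 hA).2]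
    rw [hfg]
    rfl

theorem mem_realization_iff (Γ : ColoredGraph n) (x : Γ.Cell → ℝ) :
    x ∈ Γ.toComplex.realization ↔ ∃ v t, IsFlagPoint t ∧ x = Γ.facePoint v t := by
  classical
  constructor
  · rintro ⟨h0, h1, hc⟩
    have hne : (Finset.univ.filter fun A : Γ.Cell => x A ≠ 0).Nonempty := by
      by_contra hne
      rw [Finset.not_nonempty_iff_eq_empty, Finset.filter_eq_empty_iff] at hne
      have : ∑ A, x A = 0 := Finset.sum_eq_zero fun A hA => not_not.1 (hne hA)
      exact zero_ne_one (this.symm.trans h1)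
    obtain ⟨A, hA, hmax⟩ := Finset.exists_max_image _ (fun A : Γ.Cell => A.colors.card) hne
    have hle : ∀ B, x B ≠ 0 → B ≤ A := by
      intro B hB
      rcases hc.total hB (Finset.mem_filter.1 hA).2 with h | h
      · exact h
      · have hcol := Finset.eq_of_subset_of_card_le h.1 (hmax B (by simpa using hB))
        obtain ⟨v, hv⟩ := Γ.exists_cell_eq B
        have hA' := cell_eq_of_le h hv
        rw [← hv, ← hA']
        exact (Γ.cell_eq_cell_iff.2 ⟨hcol.symm, (Γ.component _).refl v⟩).le
    obtain ⟨v, hv⟩ := Γ.exists_cell_eq A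
    let t : Finset (Fin (n + 1)) → ℝ := fun C => if hC : C.Nonempty then x (Γ.cell C hC v) else 0
    have hx : x = Γ.facePoint v t := by
      funext B
      rw [facePoint]
      by_cases hB : x B = 0
      · split_ifs with h
        · rw [hB]
          simp only [t]
          rw [dif_pos B.nonempty, h, hB]
        · exact hB
      · have := cell_eq_of_le (hle B hB) hv
        rw [if_pos this]
        simp only [t]
        rw [dif_pos B.nonempty, this]
    have ht : t ∅ = 0 := dif_neg (by simp)
    refine ⟨v, t, ⟨fun C => ?_, ht, ?_, ?_⟩, hx⟩
    · simp only [t]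
      split_ifs
      · exact h0 _
      · exact le_rfl
    · have := Γ.sum_facePoint_smul v ht (fun _ => (1 : ℝ)) (fun _ => 1) fun _ _ => rfl
      simp only [smul_eq_mul, mul_one] at this
      rw [← this, ← hx]
      exact h1
    · intro C hC D hD _
      have hcell : ∀ C, t C ≠ 0 → ∃ hC, x (Γ.cell C hC v) ≠ 0 := by
        intro C hC
        simp only [t] at hC
        split_ifs at hC with h
        · exact ⟨h, hC⟩
        · exact absurd rfl hC
      obtain ⟨hC1, hC2⟩ := hcell C hC
      obtain ⟨hD1, hD2⟩ := hcell D hD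
      exact (hc.total hC2 hD2).imp And.left And.left
  · rintro ⟨v, t, ht, rfl⟩
    refine ⟨fun A => ?_, ?_, ?_⟩
    · unfold facePoint
      split_ifs
      · exact ht.nonneg _
      · exact le_rfl
    · have := Γ.sum_facePoint_smul v ht.empty (fun _ => (1 : ℝ)) (fun _ => 1) fun _ _ => rfl
      simp only [smul_eq_mul, mul_one] at this
      exact this.trans ht.sum_eq
    · have key : ∀ A, Γ.facePoint v t A ≠ 0 →
          Γ.cell A.colors A.nonempty v = A ∧ t A.colors ≠ 0 := by
        intro A hA
        rw [facePoint] at hA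
        split_ifs at hA with h
        · exact ⟨h, hA⟩
        · exact absurd rfl hA
      intro A hA B hB _
      obtain ⟨hA1, hA2⟩ := key A hA
      obtain ⟨hB1, hB2⟩ := key B hB
      exact (ht.chain.total hA2 hB2).imp (fun h => ⟨h, v, hA1, hB1⟩) fun h => ⟨h, v, hB1, hA1⟩

theorem facePoint_eq_facePoint (Γ : ColoredGraph n) {u v : Γ.V} {s t : Finset (Fin (n + 1)) → ℝ}
    (hst : s = t) (h : ∀ C, C.Nonempty → s C ≠ 0 → Γ.component C u v) :
    Γ.facePoint u s = Γ.facePoint v t := by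
  subst hst
  funext A
  simp only [facePoint]
  by_cases hA : s A.colors = 0
  · simp [hA]
  · rw [Γ.cell_eq_cell_iff.2 ⟨rfl, h _ A.nonempty hA⟩]

/-! ### The polyhedron of `sphereGem` -/

section SphereGem

variable {k : ℕ} [NeZero k]

/-- The index of the `(n-1)`-simplex with label set `{0, …, n-1}` of `σ(v)`. -/
def axisIndex (v : ZMod k × Bool) : ZMod k := if v.2 then v.1 + 1 else v.1

theorem fst_eq_of_component {C : Finset (Fin (n + 1))} (hC : Fin.last n ∈ C)
    {u v : (sphereGem n k).V} (h : (sphereGem n k).component C u v) : u.1 = v.1 := by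
  induction h with
  | rel u v e =>
    obtain ⟨j, hj, rfl⟩ := e
    have : j ≠ Fin.last n := fun h => hj (h ▸ hC)
    simp [sphereGem, this]
  | refl => rfl
  | symm _ _ _ ih => exact ih.symm
  | trans _ _ _ _ _ ih₁ ih₂ => exact ih₁.trans ih₂

theorem axisIndex_eq_of_component {u v : (sphereGem n k).V}
    (h : (sphereGem n k).component {Fin.last n}ᶜ u v) : axisIndex u = axisIndex v := by
  induction h with
  | rel u v e =>
    obtain ⟨j, hj, rfl⟩ := e
    obtain rfl : j = Fin.last n := by simpa using hj
    obtain ⟨j, b⟩ := u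
    cases b <;> simp [sphereGem, axisIndex]
  | refl => rfl
  | symm _ _ _ ih => exact ih.symm
  | trans _ _ _ _ _ ih₁ ih₂ => exact ih₁.trans ih₂

theorem eq_of_component_univ {Γ : ColoredGraph n} {u v : Γ.V}
    (h : Γ.component Finset.univ u v) : u = v := by
  induction h with
  | rel u v e =>
    obtain ⟨j, hj, rfl⟩ := e
    exact absurd (Finset.mem_univ j) hj
  | refl => rfl
  | symm _ _ _ ih => exact ih.symm
  | trans _ _ _ _ _ ih₁ ih₂ => exact ih₁.trans ih₂

theorem component_of_fst_eq {C : Finset (Fin (n + 1))} {i : Fin (n + 1)} (hi : i ∉ C)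
    (hi' : i ≠ Fin.last n) {u v : (sphereGem n k).V} (h : u.1 = v.1) :
    (sphereGem n k).component C u v := by
  by_cases h2 : u.2 = v.2
  · obtain rfl : u = v := Prod.ext h h2
    exact .refl _
  · refine .rel _ _ ⟨i, hi, ?_⟩
    obtain ⟨j, b⟩ := u
    obtain ⟨j', b'⟩ := v
    obtain rfl : j = j' := h
    cases b <;> cases b' <;> simp_all [sphereGem]

theorem component_of_axisIndex_eq {C : Finset (Fin (n + 1))} (hC : Fin.last n ∉ C)
    {u v : (sphereGem n k).V} (h : axisIndex u = axisIndex v) :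
    (sphereGem n k).component C u v := by
  by_cases h2 : u.2 = v.2
  · have h1 : u.1 = v.1 := by
      simp only [axisIndex, h2] at h
      split_ifs at h
      exacts [add_right_cancel h, h]
    obtain rfl : u = v := Prod.ext h1 h2
    exact .refl _
  · refine .rel _ _ ⟨_, hC, ?_⟩
    obtain ⟨j, b⟩ := u
    obtain ⟨j', b'⟩ := v
    cases b <;> cases b' <;> simp_all [sphereGem, axisIndex]

theorem component_of_notMem {C : Finset (Fin (n + 1))} (hC : Fin.last n ∉ C) {i : Fin (n + 1)}
    (hi : i ∉ C) (hi' : i ≠ Fin.last n) (u v : (sphereGem n k).V) :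
    (sphereGem n k).component C u v := by
  have h0 : ∀ m : ℕ, (sphereGem n k).component C ((0 : ZMod k), false) ((m : ZMod k), false) := by
    intro m
    induction m with
    | zero =>
      rw [Nat.cast_zero]
      exact .refl _
    | succ m ih =>
      refine .trans _ _ _ ih (.trans _ ((m : ZMod k), true) _ ?_ ?_)
      · exact component_of_fst_eq hi hi' rfl
      · exact component_of_axisIndex_eq hC (by simp [axisIndex])
  have h1 : ∀ v : (sphereGem n k).V, (sphereGem n k).component C ((0 : ZMod k), false) v := by
    intro v
    have := h0 (ZMod.val v.1)
    rw [ZMod.natCast_zmod_val] at this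
    exact .trans _ _ _ this (component_of_fst_eq hi hi' rfl)
  exact .trans _ _ _ (.symm _ _ (h1 u)) (h1 v)

end SphereGem

end ColoredGraph

namespace ColoredGraph

variable {n : ℕ}

/-! ### The sphere as a join of a simplex boundary and a triangle boundary -/

/-- The linear map placing the axis, the boundary of the simplex with vertices `e_0, …, e_{n-1}`, and
a triangle with vertices the barycenter of that simplex, `e_n` and `e_{n+1}` in `ℝ^{n+2}`. -/
noncomputable def joinMap (n : ℕ) : (Fin n → ℝ) × (Fin 3 → ℝ) →ₗ[ℝ] (Fin (n + 2) → ℝ) where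
  toFun p := Fin.snoc (Fin.snoc (fun i => p.1 i + p.2 0 / n) (p.2 1) : Fin (n + 1) → ℝ) (p.2 2)
  map_add' p q := by
    funext i
    refine Fin.lastCases ?_ (fun i => ?_) i
    · simp
    · refine Fin.lastCases ?_ (fun i => ?_) i
      · simp
      · simp
        ring
  map_smul' c p := by
    funext i
    refine Fin.lastCases ?_ (fun i => ?_) i
    · simp
    · refine Fin.lastCases ?_ (fun i => ?_) i
      · simp
      · simp
        ring

theorem joinMap_castSucc_castSucc (p : (Fin n → ℝ) × (Fin 3 → ℝ)) (i : Fin n) :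
    joinMap n p i.castSucc.castSucc = p.1 i + p.2 0 / n := by
  simp [joinMap]

theorem joinMap_castSucc_last (p : (Fin n → ℝ) × (Fin 3 → ℝ)) :
    joinMap n p (Fin.last n).castSucc = p.2 1 := by
  simp [joinMap]

theorem joinMap_last (p : (Fin n → ℝ) × (Fin 3 → ℝ)) :
    joinMap n p (Fin.last (n + 1)) = p.2 2 := by
  simp [joinMap]

theorem sum_joinMap (hn : 1 ≤ n) (p : (Fin n → ℝ) × (Fin 3 → ℝ)) :
    ∑ i, joinMap n p i = ∑ i, p.1 i + ∑ l, p.2 l := by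
  have hn' : (n : ℝ) ≠ 0 := by exact_mod_cast (by omega : n ≠ 0)
  rw [Fin.sum_univ_castSucc, Fin.sum_univ_castSucc, joinMap_last, joinMap_castSucc_last]
  simp only [joinMap_castSucc_castSucc, Finset.sum_add_distrib, Finset.sum_const, Finset.card_univ,
    Fintype.card_fin, nsmul_eq_mul, Fin.sum_univ_three]
  field_simp
  ring

/-- `p` has a point of the axis and a point of the cone over the boundary of the triangle as its
components; in both cases some coordinate vanishes. -/
structure IsJoinPoint (p : (Fin n → ℝ) × (Fin 3 → ℝ)) : Prop where
  nonneg_fst : ∀ i, 0 ≤ p.1 i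
  nonneg_snd : ∀ l, 0 ≤ p.2 l
  exists_fst : ∃ i, p.1 i = 0
  exists_snd : ∃ l, p.2 l = 0

theorem IsJoinPoint.joinMap_mem (hn : 1 ≤ n) {p : (Fin n → ℝ) × (Fin 3 → ℝ)} (hp : IsJoinPoint p)
    (h1 : ∑ i, p.1 i + ∑ l, p.2 l = 1) : joinMap n p ∈ plSphere n := by
  refine ⟨⟨fun i => ?_, (sum_joinMap hn p).trans h1⟩, ?_⟩
  · refine Fin.lastCases ?_ (fun i => ?_) i
    · rw [joinMap_last]
      exact hp.nonneg_snd 2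
    · refine Fin.lastCases ?_ (fun i => ?_) i
      · rw [joinMap_castSucc_last]
        exact hp.nonneg_snd 1
      · rw [joinMap_castSucc_castSucc]
        exact add_nonneg (hp.nonneg_fst i) (div_nonneg (hp.nonneg_snd 0) n.cast_nonneg)
  · obtain ⟨i, hi⟩ := hp.exists_fst
    obtain ⟨l, hl⟩ := hp.exists_snd
    fin_cases l
    · refine ⟨i.castSucc.castSucc, ?_⟩
      rw [joinMap_castSucc_castSucc, hi]
      simpa using Or.inl hl
    · exact ⟨(Fin.last n).castSucc, (joinMap_castSucc_last p).trans hl⟩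
    · exact ⟨Fin.last (n + 1), (joinMap_last p).trans hl⟩

/-- The coordinate at the barycenter of the axis simplex is recovered as a minimum. -/
theorem IsJoinPoint.joinMap_inj (hn : 1 ≤ n) {p q : (Fin n → ℝ) × (Fin 3 → ℝ)} (hp : IsJoinPoint p)
    (hq : IsJoinPoint q) (h : joinMap n p = joinMap n q) : p = q := by
  have hn' : (0 : ℝ) < n := by exact_mod_cast hn
  have hi : ∀ i, p.1 i + p.2 0 / n = q.1 i + q.2 0 / n := fun i => by
    rw [← joinMap_castSucc_castSucc, ← joinMap_castSucc_castSucc, h]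
  have h0 : p.2 0 / n = q.2 0 / n := by
    obtain ⟨i, hpi⟩ := hp.exists_fst
    obtain ⟨j, hqj⟩ := hq.exists_fst
    have e1 := hi i
    have e2 := hi j
    have := hq.nonneg_fst i
    have := hp.nonneg_fst j
    linarith
  refine Prod.ext (funext fun i => ?_) (funext fun l => ?_)
  · have := hi i
    rw [h0] at this
    exact add_right_cancel this
  · fin_cases l
    · exact (div_left_inj' hn'.ne').1 h0
    · have := congrFun h (Fin.last n).castSucc
      rwa [joinMap_castSucc_last, joinMap_castSucc_last] at this
    · have := congrFun h (Fin.last (n + 1))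
      rwa [joinMap_last, joinMap_last] at this

theorem exists_joinMap_eq (hn : 1 ≤ n) {x : Fin (n + 2) → ℝ} (hx : x ∈ plSphere n) :
    ∃ p, IsJoinPoint p ∧ joinMap n p = x := by
  have hn' : (n : ℝ) ≠ 0 := by exact_mod_cast (by omega : n ≠ 0)
  obtain ⟨⟨h0, h1⟩, j, hj⟩ := hx
  have : Nonempty (Fin n) := ⟨⟨0, hn⟩⟩
  obtain ⟨i₀, hmin⟩ := Finite.exists_min fun i : Fin n => x i.castSucc.castSucc
  refine ⟨(fun i => x i.castSucc.castSucc - x i₀.castSucc.castSucc,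
    ![n * x i₀.castSucc.castSucc, x (Fin.last n).castSucc, x (Fin.last (n + 1))]), ⟨?_, ?_, ?_, ?_⟩,
    ?_⟩
  · exact fun i => sub_nonneg.2 (hmin i)
  · intro l
    fin_cases l
    exacts [mul_nonneg n.cast_nonneg (h0 _), h0 _, h0 _]
  · exact ⟨i₀, sub_self _⟩
  · revert hj
    refine Fin.lastCases (fun hj => ⟨2, hj⟩) (fun j => ?_) j
    refine Fin.lastCases (fun hj => ⟨1, hj⟩) (fun j hj => ⟨0, ?_⟩) j
    have : x i₀.castSucc.castSucc = 0 := le_antisymm (hj ▸ hmin j) (h0 _)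
    simp [this]
  · funext i
    refine Fin.lastCases ?_ (fun i => ?_) i
    · rw [joinMap_last]
      rfl
    · refine Fin.lastCases ?_ (fun i => ?_) i
      · rw [joinMap_castSucc_last]
        rfl
      · rw [joinMap_castSucc_castSucc]
        simp [mul_div_cancel_left₀ _ hn']

/-! ### The PL homeomorphism -/

section SphereGem

variable {k : ℕ}

/-- The position on the cycle of the barycenter of the axis simplex of `σ(v)`. -/
def axisPos (v : ZMod k × Bool) : ℕ := 4 * (axisIndex v).val

/-- The position on the cycle of the barycenter of `σ(v)`. -/
def facetPos (v : ZMod k × Bool) : ℕ := 4 * v.1.val + 1 + 2 * v.2.toNat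

/-- The position on the cycle of the vertex of `σ(v)` of color `n`. -/
def apexPos (v : ZMod k × Bool) : ℕ := 4 * v.1.val + 2

theorem axisPos_ne_facetPos (u v : ZMod k × Bool) : axisPos u ≠ facetPos v := by
  unfold axisPos facetPos
  omega

theorem axisPos_ne_apexPos (u v : ZMod k × Bool) : axisPos u ≠ apexPos v := by
  unfold axisPos apexPos
  omega

theorem facetPos_ne_apexPos (u v : ZMod k × Bool) : facetPos u ≠ apexPos v := by
  unfold facetPos apexPos
  omega

theorem axisPos_false (j : ZMod k) : axisPos (j, false) = 4 * j.val := rfl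

/-- The coefficients on the cycle of a point of `σ(v)`: `r` at its axis simplex, `z` at its
barycenter and `q` at its vertex of color `n`. -/
def cycleWeight (v : ZMod k × Bool) (r z q : ℝ) (m : ℕ) : ℝ :=
  (if axisPos v = m then r else 0) + (if facetPos v = m then z else 0) +
    (if apexPos v = m then q else 0)

theorem cycleWeight_nonneg (v : ZMod k × Bool) {r z q : ℝ} (hr : 0 ≤ r) (hz : 0 ≤ z) (hq : 0 ≤ q)
    (m : ℕ) : 0 ≤ cycleWeight v r z q m := by
  unfold cycleWeight
  refine add_nonneg (add_nonneg ?_ ?_) ?_ <;> split_ifs <;> first | assumption | exact le_rfl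

variable [NeZero k]

theorem axisPos_lt (v : ZMod k × Bool) : axisPos v < 4 * k := by
  have := ZMod.val_lt (axisIndex v)
  unfold axisPos
  omega

theorem facetPos_lt (v : ZMod k × Bool) : facetPos v < 4 * k := by
  have := ZMod.val_lt v.1
  have := v.2.toNat_le
  unfold facetPos
  omega

theorem apexPos_lt (v : ZMod k × Bool) : apexPos v < 4 * k := by
  have := ZMod.val_lt v.1
  unfold apexPos
  omega

theorem axisPos_inj {u v : ZMod k × Bool} : axisPos u = axisPos v ↔ axisIndex u = axisIndex v := by
  rw [← (ZMod.val_injective k).eq_iff]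
  unfold axisPos
  omega

theorem facetPos_inj {u v : ZMod k × Bool} : facetPos u = facetPos v ↔ u = v := by
  refine ⟨fun h => ?_, fun h => h ▸ rfl⟩
  obtain ⟨i, b⟩ := u
  obtain ⟨j, c⟩ := v
  have hb := b.toNat_le
  have hc := c.toNat_le
  simp only [facetPos] at h
  have h1 : i = j := ZMod.val_injective k (by omega)
  have h2 : b.toNat = c.toNat := by omega
  cases b <;> cases c <;> simp_all

theorem apexPos_inj {u v : ZMod k × Bool} : apexPos u = apexPos v ↔ u.1 = v.1 := by
  rw [← (ZMod.val_injective k).eq_iff]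
  unfold apexPos
  omega

theorem axisPos_true (j : ZMod k) : axisPos (j, true) = (4 * j.val + 4) % (4 * k) := by
  have h : ((j + 1 : ZMod k)).val = (j.val + 1) % k := by
    rw [ZMod.val_add, ZMod.val_one_eq_one_mod, Nat.add_mod_mod]
  have : axisPos (j, true) = 4 * (j + 1 : ZMod k).val := rfl
  rw [this, h, ← Nat.mul_mod_mul_left, mul_add, mul_one]

/-- The position of `σ(v)` is cyclically adjacent to the one of its axis simplex. -/
theorem axisPos_facetPos_adj (v : ZMod k × Bool) :
    (axisPos v + 1) % (4 * k) = facetPos v ∨ axisPos v = (facetPos v + 1) % (4 * k) := by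
  obtain ⟨j, b⟩ := v
  have := ZMod.val_lt j
  cases b
  · left
    rw [axisPos_false, Nat.mod_eq_of_lt (by omega)]
    simp [facetPos]
  · right
    rw [axisPos_true]
    simp [facetPos]

/-- The position of `σ(v)` is cyclically adjacent to the one of its vertex of color `n`. -/
theorem apexPos_facetPos_adj (v : ZMod k × Bool) :
    (apexPos v + 1) % (4 * k) = facetPos v ∨ apexPos v = (facetPos v + 1) % (4 * k) := by
  obtain ⟨j, b⟩ := v
  have := ZMod.val_lt j
  cases b
  · right
    have : facetPos (j, false) = 4 * j.val + 1 := rfl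
    rw [this, Nat.mod_eq_of_lt (by omega)]
    rfl
  · left
    have : apexPos (j, true) = 4 * j.val + 2 := rfl
    rw [this, Nat.mod_eq_of_lt (by omega)]
    rfl

/-- Every edge of the cycle joins the position of a facet to that of its axis simplex or to that of
its vertex of color `n`. -/
theorem exists_facetPos_edge {i : ℕ} (hi : i < 4 * k) : ∃ v : ZMod k × Bool,
    (i = axisPos v ∧ (i + 1) % (4 * k) = facetPos v) ∨
    (i = facetPos v ∧ (i + 1) % (4 * k) = apexPos v) ∨
    (i = apexPos v ∧ (i + 1) % (4 * k) = facetPos v) ∨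
    (i = facetPos v ∧ (i + 1) % (4 * k) = axisPos v) := by
  have hval : ((i / 4 : ℕ) : ZMod k).val = i / 4 := ZMod.val_cast_of_lt (by omega)
  have hcase : i % 4 = 0 ∨ i % 4 = 1 ∨ i % 4 = 2 ∨ i % 4 = 3 := by omega
  rcases hcase with h | h | h | h
  · refine ⟨(((i / 4 : ℕ) : ZMod k), false), Or.inl ⟨?_, ?_⟩⟩
    · rw [axisPos_false, hval]
      omega
    · rw [Nat.mod_eq_of_lt (by omega)]
      simp only [facetPos, hval, Bool.toNat_false]
      omega
  · refine ⟨(((i / 4 : ℕ) : ZMod k), false), Or.inr (Or.inl ⟨?_, ?_⟩)⟩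
    · simp only [facetPos, hval, Bool.toNat_false]
      omega
    · rw [Nat.mod_eq_of_lt (by omega)]
      simp only [apexPos, hval]
      omega
  · refine ⟨(((i / 4 : ℕ) : ZMod k), true), Or.inr (Or.inr (Or.inl ⟨?_, ?_⟩))⟩
    · simp only [apexPos, hval]
      omega
    · rw [Nat.mod_eq_of_lt (by omega)]
      simp only [facetPos, hval, Bool.toNat_true]
      omega
  · refine ⟨(((i / 4 : ℕ) : ZMod k), true), Or.inr (Or.inr (Or.inr ⟨?_, ?_⟩))⟩
    · simp only [facetPos, hval, Bool.toNat_true]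
      omega
    · rw [axisPos_true, hval]
      congr 1
      omega

theorem sum_cycleWeight_smul (v : ZMod k × Bool) (r z q : ℝ) (f : ℕ → Fin 3 → ℝ) :
    ∑ m ∈ Finset.range (4 * k), cycleWeight v r z q m • f m =
      r • f (axisPos v) + z • f (facetPos v) + q • f (apexPos v) := by
  simp only [cycleWeight, add_smul, ite_smul, zero_smul, Finset.sum_add_distrib, Finset.sum_ite_eq,
    Finset.mem_range, axisPos_lt, facetPos_lt, apexPos_lt, if_true]

theorem isCyclicPair_cycleWeight (v : ZMod k × Bool) {r z q : ℝ} (h : r = 0 ∨ q = 0) :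
    IsCyclicPair (4 * k) (cycleWeight v r z q) := by
  have aux : ∀ a b : ℕ, a < 4 * k → b < 4 * k → ((a + 1) % (4 * k) = b ∨ a = (b + 1) % (4 * k)) →
      (∀ m, cycleWeight v r z q m ≠ 0 → m = a ∨ m = b) →
      IsCyclicPair (4 * k) (cycleWeight v r z q) := by
    intro a b ha hb hab hm
    rcases hab with hab | hab
    · exact ⟨a, ha, fun m _ h => hab ▸ hm m h⟩
    · exact ⟨b, hb, fun m _ h => hab ▸ (hm m h).symm⟩
  rcases h with rfl | rfl
  · refine aux _ _ (apexPos_lt v) (facetPos_lt v) (apexPos_facetPos_adj v) fun m hm => ?_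
    by_contra! hne
    exact hm (by simp [cycleWeight, hne.1.symm, hne.2.symm])
  · refine aux _ _ (axisPos_lt v) (facetPos_lt v) (axisPos_facetPos_adj v) fun m hm => ?_
    by_contra! hne
    exact hm (by simp [cycleWeight, hne.1.symm, hne.2.symm])

/-- The weight of the vertices of a face with label set `C` in the image of its barycenter: the
barycenters of facets and of axis simplices are placed on the cycle, apart from their vertices. -/
noncomputable def faceWeight (C : Finset (Fin (n + 1))) : ℝ :=
  if C = Finset.univ ∨ C = {Fin.last n}ᶜ then 0 else (C.card : ℝ)⁻¹

/-- The component along the cycle of the image of the barycenter of a face of `σ(v)`. -/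
noncomputable def circleCoord (C : Finset (Fin (n + 1))) (v : ZMod k × Bool) : Fin 3 → ℝ :=
  (if C = {Fin.last n}ᶜ then cyclePoint (4 * k) (axisPos v) else 0) +
  (if C = Finset.univ then cyclePoint (4 * k) (facetPos v) else 0) +
  if Fin.last n ∈ C then faceWeight C • cyclePoint (4 * k) (apexPos v) else 0

/-- The image, in the join of the axis and of the cycle, of the barycenter of a face of `σ(v)`. -/
noncomputable def joinCoord (C : Finset (Fin (n + 1))) (v : ZMod k × Bool) :
    (Fin n → ℝ) × (Fin 3 → ℝ) :=
  (fun i => if i.castSucc ∈ C then faceWeight C else 0, circleCoord C v)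

theorem joinCoord_congr {C : Finset (Fin (n + 1))} {u v : ZMod k × Bool}
    (h : (sphereGem n k).component C u v) : joinCoord C u = joinCoord C v := by
  have h1 : (if C = {Fin.last n}ᶜ then cyclePoint (4 * k) (axisPos u) else 0) =
      if C = {Fin.last n}ᶜ then cyclePoint (4 * k) (axisPos v) else 0 := by
    split_ifs with hC
    · exact congrArg _ (axisPos_inj.2 (axisIndex_eq_of_component (n := n) (hC ▸ h)))
    · rfl
  have h2 : (if C = Finset.univ then cyclePoint (4 * k) (facetPos u) else 0) =
      if C = Finset.univ then cyclePoint (4 * k) (facetPos v) else 0 := by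
    split_ifs with hC
    · rw [facetPos_inj.2 (eq_of_component_univ (hC ▸ h))]
    · rfl
  have h3 : (if Fin.last n ∈ C then faceWeight C • cyclePoint (4 * k) (apexPos u) else 0) =
      if Fin.last n ∈ C then faceWeight C • cyclePoint (4 * k) (apexPos v) else 0 := by
    split_ifs with hC
    · rw [apexPos_inj.2 (fst_eq_of_component hC h)]
    · rfl
  simp only [joinCoord, circleCoord, h1, h2, h3]

theorem axis_ne_univ : ({Fin.last n}ᶜ : Finset (Fin (n + 1))) ≠ Finset.univ := by
  intro h
  simpa using (h ▸ Finset.mem_univ (Fin.last n) : Fin.last n ∈ ({Fin.last n}ᶜ : Finset _))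

theorem sum_joinCoord {C : Finset (Fin (n + 1))} (hC : C.Nonempty) (v : ZMod k × Bool) :
    ∑ i, (joinCoord C v).1 i + ∑ l, (joinCoord C v).2 l = 1 := by
  have hN : 3 ≤ 4 * k := by have := NeZero.pos k; omega
  simp only [joinCoord, circleCoord, Pi.add_apply, Finset.sum_add_distrib]
  by_cases h1 : C = {Fin.last n}ᶜ
  · have hw : faceWeight C = 0 := if_pos (Or.inr h1)
    have h2 : C ≠ Finset.univ := h1 ▸ axis_ne_univ
    simp only [hw, if_pos h1, if_neg h2, sum_cyclePoint hN]
    simp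
  by_cases h2 : C = Finset.univ
  · have hw : faceWeight C = 0 := if_pos (Or.inl h2)
    simp only [hw, if_neg h1, if_pos h2, sum_cyclePoint hN]
    simp
  have hw : faceWeight C = (C.card : ℝ)⁻¹ := if_neg (not_or.2 ⟨h2, h1⟩)
  have h3 : ∑ l, (if Fin.last n ∈ C then faceWeight C • cyclePoint (4 * k) (apexPos v) else 0) l =
      if Fin.last n ∈ C then faceWeight C else 0 := by
    split_ifs
    · simp [← Finset.mul_sum, sum_cyclePoint hN]
    · simp
  simp only [if_neg h1, if_neg h2, h3, Pi.zero_apply, Finset.sum_const_zero, zero_add]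
  rw [← Fin.sum_univ_castSucc (fun i => if i ∈ C then faceWeight C else 0), Finset.sum_ite_mem,
    Finset.univ_inter, Finset.sum_const, nsmul_eq_mul, hw]
  exact mul_inv_cancel₀ (by exact_mod_cast hC.card_pos.ne')

/-- The point of the join of the axis and of the cycle that corresponds to a point of `σ(v)`. -/
theorem sum_smul_joinCoord (t : Finset (Fin (n + 1)) → ℝ) (v : ZMod k × Bool) :
    (∑ C, t C • joinCoord C v : (Fin n → ℝ) × (Fin 3 → ℝ)) =
      (fun i => ∑ C with i.castSucc ∈ C, t C * faceWeight C,
        ∑ m ∈ Finset.range (4 * k), cycleWeight v (t {Fin.last n}ᶜ) (t Finset.univ)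
          (∑ C with Fin.last n ∈ C, t C * faceWeight C) m • cyclePoint (4 * k) m) := by
  refine Prod.ext ?_ ?_
  · funext i
    simp only [Prod.fst_sum, Finset.sum_apply, Finset.sum_filter]
    refine Finset.sum_congr rfl fun C _ => ?_
    simp only [joinCoord, Prod.smul_fst, Pi.smul_apply, smul_eq_mul]
    split_ifs <;> simp
  · rw [sum_cycleWeight_smul]
    simp only [Prod.snd_sum, joinCoord, Prod.smul_snd, circleCoord, smul_add, smul_ite, smul_zero,
      Finset.sum_add_distrib, Finset.sum_ite_eq', Finset.mem_univ, if_true, smul_smul]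
    rw [← Finset.sum_filter, ← Finset.sum_smul]

end SphereGem

end ColoredGraph

namespace ColoredGraph

variable {n : ℕ} {k : ℕ} [NeZero k]

theorem faceWeight_nonneg (C : Finset (Fin (n + 1))) : 0 ≤ faceWeight C := by
  unfold faceWeight
  split_ifs
  · exact le_rfl
  · positivity

theorem axis_nonempty (hn : 1 ≤ n) : ({Fin.last n}ᶜ : Finset (Fin (n + 1))).Nonempty := by
  refine ⟨0, ?_⟩
  rw [Finset.mem_compl, Finset.mem_singleton, ← Fin.val_inj]
  simp
  omega

theorem eq_axis_or_univ {C : Finset (Fin (n + 1))} (h : {Fin.last n}ᶜ ⊆ C) :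
    C = Finset.univ ∨ C = {Fin.last n}ᶜ := by
  by_cases hl : Fin.last n ∈ C
  · left
    refine Finset.eq_univ_of_forall fun i => ?_
    by_cases hi : i = Fin.last n
    · exact hi ▸ hl
    · exact h (by simpa using hi)
  · right
    refine (Finset.Subset.antisymm (fun i hi => ?_) h)
    rw [Finset.mem_compl, Finset.mem_singleton]
    rintro rfl
    exact hl hi

/-- The coefficients of the part of a point that lies off the cycle form a layer-cake
decomposition. -/
theorem IsFlagPoint.chain_mul_faceWeight {t : Finset (Fin (n + 1)) → ℝ} (ht : IsFlagPoint t) :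
    IsChain (· ⊆ ·) {C | t C * faceWeight C ≠ 0} :=
  ht.chain.mono fun _ h => left_ne_zero_of_mul h

theorem IsFlagPoint.exists_sum_eq_zero (hn : 1 ≤ n) {t : Finset (Fin (n + 1)) → ℝ}
    (ht : IsFlagPoint t) : ∃ i : Fin n, ∑ C with i.castSucc ∈ C, t C * faceWeight C = 0 := by
  obtain ⟨i, hi, h⟩ := exists_mem_forall_subset_of_isChain
    (T := Finset.univ.filter fun C => t C * faceWeight C ≠ 0)
    (by simpa using ht.chain_mul_faceWeight) (axis_nonempty hn)
  obtain ⟨i, rfl⟩ := Fin.exists_castSucc_eq.2 (by simpa using hi)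
  refine ⟨i, Finset.sum_eq_zero fun C hC => ?_⟩
  by_contra hne
  refine right_ne_zero_of_mul hne (if_pos (eq_axis_or_univ (h C ?_ (Finset.mem_filter.1 hC).2)))
  exact Finset.mem_filter.2 ⟨Finset.mem_univ _, hne⟩

/-- A point of a simplex of the subdivision does not have both a coordinate at the axis simplex and
one at a proper face that contains the vertex of color `n`. -/
theorem IsFlagPoint.eq_zero_or {t : Finset (Fin (n + 1)) → ℝ} (ht : IsFlagPoint t) :
    t {Fin.last n}ᶜ = 0 ∨ ∑ C with Fin.last n ∈ C, t C * faceWeight C = 0 := by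
  rw [or_iff_not_imp_left]
  intro h
  refine Finset.sum_eq_zero fun C hC => ?_
  by_contra hne
  have hl := (Finset.mem_filter.1 hC).2
  refine right_ne_zero_of_mul hne (if_pos (eq_axis_or_univ ?_))
  rcases ht.chain.total h (left_ne_zero_of_mul hne) with h' | h'
  · exact h'
  · simpa using h' hl

theorem three_le_four_mul (k : ℕ) [NeZero k] : 3 ≤ 4 * k := by
  have := NeZero.pos k
  omega

theorem IsFlagPoint.sum_mul_faceWeight_nonneg {t : Finset (Fin (n + 1)) → ℝ} (ht : IsFlagPoint t)
    (i : Fin (n + 1)) : 0 ≤ ∑ C with i ∈ C, t C * faceWeight C :=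
  Finset.sum_nonneg fun C _ => mul_nonneg (ht.nonneg C) (faceWeight_nonneg C)

theorem IsFlagPoint.isJoinPoint (hn : 1 ≤ n) {t : Finset (Fin (n + 1)) → ℝ} (ht : IsFlagPoint t)
    (v : ZMod k × Bool) : IsJoinPoint (∑ C, t C • joinCoord C v) := by
  rw [sum_smul_joinCoord]
  refine ⟨fun i => ht.sum_mul_faceWeight_nonneg _, fun l => ?_, ht.exists_sum_eq_zero hn,
    (isCyclicPair_cycleWeight v ht.eq_zero_or).exists_sum_eq_zero (three_le_four_mul k)⟩
  dsimp only
  rw [Finset.sum_apply]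
  exact Finset.sum_nonneg fun m hm => mul_nonneg
    (cycleWeight_nonneg v (ht.nonneg _) (ht.nonneg _) (ht.sum_mul_faceWeight_nonneg _) m)
    (cyclePoint_nonneg (three_le_four_mul k) (Finset.mem_range.1 hm) l)

theorem sum_sum_smul_joinCoord {t : Finset (Fin (n + 1)) → ℝ} (ht : t ∅ = 0) (v : ZMod k × Bool) :
    ∑ i, (∑ C, t C • joinCoord C v : (Fin n → ℝ) × (Fin 3 → ℝ)).1 i +
      ∑ l, (∑ C, t C • joinCoord C v : (Fin n → ℝ) × (Fin 3 → ℝ)).2 l = ∑ C, t C := by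
  simp only [Prod.fst_sum, Prod.snd_sum, Finset.sum_apply, Prod.smul_fst, Prod.smul_snd,
    Pi.smul_apply, smul_eq_mul]
  rw [Finset.sum_comm, Finset.sum_comm (s := (Finset.univ : Finset (Fin 3))),
    ← Finset.sum_add_distrib]
  refine Finset.sum_congr rfl fun C _ => ?_
  rw [← Finset.mul_sum, ← Finset.mul_sum, ← mul_add]
  rcases C.eq_empty_or_nonempty with rfl | hC
  · rw [ht, zero_mul]
  · rw [sum_joinCoord hC, mul_one]

theorem cycleWeight_axisPos (u v : ZMod k × Bool) (r z q : ℝ) :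
    cycleWeight v r z q (axisPos u) = if axisIndex v = axisIndex u then r else 0 := by
  simp [cycleWeight, axisPos_inj, (axisPos_ne_facetPos _ _).symm, (axisPos_ne_apexPos _ _).symm]

theorem cycleWeight_facetPos (u v : ZMod k × Bool) (r z q : ℝ) :
    cycleWeight v r z q (facetPos u) = if v = u then z else 0 := by
  simp [cycleWeight, facetPos_inj, axisPos_ne_facetPos, (facetPos_ne_apexPos _ _).symm]

theorem cycleWeight_apexPos (u v : ZMod k × Bool) (r z q : ℝ) :
    cycleWeight v r z q (apexPos u) = if v.1 = u.1 then q else 0 := by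
  simp [cycleWeight, apexPos_inj, axisPos_ne_apexPos, facetPos_ne_apexPos]

/-- Comparing two functions on an indexed family, each supported on the indices equivalent to a
single one. -/
theorem eq_and_of_ite_eq {α β : Type*} [DecidableEq β] {f : α → β} {u v : α} {a b : ℝ}
    (hu : (if f u = f u then a else 0) = if f v = f u then b else 0)
    (hv : (if f u = f v then a else 0) = if f v = f v then b else 0) :
    a = b ∧ (a ≠ 0 → f u = f v) := by
  rw [if_pos rfl] at hu hv
  by_cases h : f v = f u
  · rw [if_pos h] at hu
    exact ⟨hu, fun _ => h.symm⟩
  · rw [if_neg h] at hu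
    rw [if_neg (Ne.symm h)] at hv
    exact ⟨hu.trans hv, fun ha => absurd hu ha⟩

theorem facePoint_eq_of_sum_smul_joinCoord_eq {s t : Finset (Fin (n + 1)) → ℝ} (hs : IsFlagPoint s)
    (ht : IsFlagPoint t) {u v : ZMod k × Bool}
    (h : ∑ C, s C • joinCoord C u = ∑ C, t C • joinCoord C v) :
    (sphereGem n k).facePoint u s = (sphereGem n k).facePoint v t := by
  rw [sum_smul_joinCoord, sum_smul_joinCoord, Prod.mk.injEq] at h
  obtain ⟨h1, h2⟩ := h
  set q := ∑ C with Fin.last n ∈ C, s C * faceWeight C with hq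
  set q' := ∑ C with Fin.last n ∈ C, t C * faceWeight C with hq'
  have hc : ∀ m, m < 4 * k → cycleWeight u (s {Fin.last n}ᶜ) (s Finset.univ) q m =
      cycleWeight v (t {Fin.last n}ᶜ) (t Finset.univ) q' m := fun m hm =>
    (isCyclicPair_cycleWeight u hs.eq_zero_or).eq_of_sum_cyclePoint_eq (three_le_four_mul k)
      (cycleWeight_nonneg u (hs.nonneg _) (hs.nonneg _) (hs.sum_mul_faceWeight_nonneg _))
      (cycleWeight_nonneg v (ht.nonneg _) (ht.nonneg _) (ht.sum_mul_faceWeight_nonneg _))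
      (isCyclicPair_cycleWeight v ht.eq_zero_or) h2 hm
  obtain ⟨hr1, hr2⟩ : s {Fin.last n}ᶜ = t {Fin.last n}ᶜ ∧
      (s {Fin.last n}ᶜ ≠ 0 → axisIndex u = axisIndex v) := by
    have e1 := hc _ (axisPos_lt u)
    have e2 := hc _ (axisPos_lt v)
    rw [cycleWeight_axisPos, cycleWeight_axisPos] at e1 e2
    exact eq_and_of_ite_eq e1 e2
  obtain ⟨hz1, hz2⟩ : s Finset.univ = t Finset.univ ∧ (s Finset.univ ≠ 0 → u = v) := by
    have e1 := hc _ (facetPos_lt u)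
    have e2 := hc _ (facetPos_lt v)
    rw [cycleWeight_facetPos, cycleWeight_facetPos] at e1 e2
    exact eq_and_of_ite_eq (f := id) e1 e2
  obtain ⟨hq1, hq2⟩ : q = q' ∧ (q ≠ 0 → u.1 = v.1) := by
    have e1 := hc _ (apexPos_lt u)
    have e2 := hc _ (apexPos_lt v)
    rw [cycleWeight_apexPos, cycleWeight_apexPos] at e1 e2
    exact eq_and_of_ite_eq (f := Prod.fst) e1 e2
  have hw : (fun C => s C * faceWeight C) = fun C => t C * faceWeight C := by
    refine eq_of_sum_mem_eq (fun C => mul_nonneg (hs.nonneg C) (faceWeight_nonneg C))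
      (fun C => mul_nonneg (ht.nonneg C) (faceWeight_nonneg C)) hs.chain_mul_faceWeight
      ht.chain_mul_faceWeight (fun i => ?_) (by rw [hs.empty, ht.empty])
    exact Fin.lastCases hq1 (fun i => congrFun h1 i) i
  have hfw : ∀ C : Finset (Fin (n + 1)), C.Nonempty → C ≠ Finset.univ → C ≠ {Fin.last n}ᶜ →
      faceWeight C ≠ 0 := by
    intro C hC h1 h2
    rw [faceWeight, if_neg (not_or.2 ⟨h1, h2⟩)]
    exact inv_ne_zero (by exact_mod_cast hC.card_pos.ne')
  refine facePoint_eq_facePoint _ (funext fun C => ?_) fun C hC hsC => ?_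
  · rcases C.eq_empty_or_nonempty with rfl | hC
    · rw [hs.empty, ht.empty]
    by_cases h1 : C = Finset.univ
    · rw [h1, hz1]
    by_cases h2 : C = {Fin.last n}ᶜ
    · rw [h2, hr1]
    exact mul_right_cancel₀ (hfw C hC h1 h2) (congrFun hw C)
  · by_cases h1 : C = Finset.univ
    · rw [hz2 (h1 ▸ hsC)]
      exact .refl _
    by_cases h2 : C = {Fin.last n}ᶜ
    · exact component_of_axisIndex_eq (by simp [h2]) (hr2 (h2 ▸ hsC))
    obtain ⟨i, hi, hiC⟩ : ∃ i, i ≠ Fin.last n ∧ i ∉ C := by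
      by_contra! hne
      rcases eq_axis_or_univ (C := C) fun i hi => hne i (by simpa using hi) with h | h
      exacts [h1 h, h2 h]
    by_cases hl : Fin.last n ∈ C
    · refine component_of_fst_eq hiC hi (hq2 ?_)
      refine (Finset.sum_pos' (fun D _ => mul_nonneg (hs.nonneg D) (faceWeight_nonneg D))
        ⟨C, by simpa using hl, ?_⟩).ne'
      exact mul_pos ((hs.nonneg C).lt_of_ne' hsC)
        ((faceWeight_nonneg C).lt_of_ne' (hfw C hC h1 h2))
    · exact component_of_notMem hl hiC hi u v

theorem exists_isFlagPoint_of_isJoinPoint (hn : 1 ≤ n) (k : ℕ) [NeZero k]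
    {p : (Fin n → ℝ) × (Fin 3 → ℝ)} (hp : IsJoinPoint p)
    (h1 : ∑ i, p.1 i + ∑ l, p.2 l = 1) :
    ∃ (v : ZMod k × Bool) (t : Finset (Fin (n + 1)) → ℝ), IsFlagPoint t ∧
      ∑ C, t C • joinCoord C v = p := by
  obtain ⟨v, r, z, q, hr, hz, hq, hrq, hx⟩ : ∃ (v : ZMod k × Bool) (r z q : ℝ), 0 ≤ r ∧ 0 ≤ z ∧
      0 ≤ q ∧ (r = 0 ∨ q = 0) ∧ r • cyclePoint (4 * k) (axisPos v) +
        z • cyclePoint (4 * k) (facetPos v) + q • cyclePoint (4 * k) (apexPos v) = p.2 := by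
    obtain ⟨i, hi, a, b, ha, hb, hab⟩ :=
      exists_cyclePoint_eq (three_le_four_mul k) hp.nonneg_snd hp.exists_snd
    obtain ⟨v, h⟩ := exists_facetPos_edge hi
    rw [← hab]
    rcases h with ⟨e1, e2⟩ | ⟨e1, e2⟩ | ⟨e1, e2⟩ | ⟨e1, e2⟩ <;> rw [e2, e1]
    · exact ⟨v, a, b, 0, ha, hb, le_rfl, Or.inr rfl, by rw [zero_smul, add_zero]⟩
    · exact ⟨v, 0, a, b, le_rfl, ha, hb, Or.inl rfl, by rw [zero_smul, zero_add]⟩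
    · exact ⟨v, 0, b, a, le_rfl, hb, ha, Or.inl rfl, by rw [zero_smul, zero_add, add_comm]⟩
    · exact ⟨v, b, a, 0, hb, ha, le_rfl, Or.inr rfl, by rw [zero_smul, add_zero, add_comm]⟩
  obtain ⟨a, ha0, hae, hac, has⟩ := exists_sum_mem_eq
    (Fin.snoc (α := fun _ => ℝ) p.1 q : Fin (n + 1) → ℝ) fun i =>
      Fin.lastCases (by simpa using hq) (fun i => by simpa using hp.nonneg_fst i) i
  have hmem : ∀ C i, i ∈ C → ∑ C with i ∈ C, a C = 0 → a C = 0 := fun C i hi h =>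
    (Finset.sum_eq_zero_iff_of_nonneg fun D _ => ha0 D).1 h C (by simpa using hi)
  have haxis : ∀ C, {Fin.last n}ᶜ ⊆ C → a C = 0 := by
    obtain ⟨i, hi⟩ := hp.exists_fst
    refine fun C hC => hmem C i.castSucc (hC (by simp)) ?_
    rw [has, Fin.snoc_castSucc, hi]
  -- the sets carrying `a` are proper, and they lie in the axis simplex if `r ≠ 0`
  have hrsub : r ≠ 0 → ∀ C, a C ≠ 0 → C ⊆ {Fin.last n}ᶜ := by
    intro hr0 C hC i hi
    rw [Finset.mem_compl, Finset.mem_singleton]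
    rintro rfl
    refine hC (hmem C _ hi ?_)
    rw [has, Fin.snoc_last]
    exact hrq.resolve_left hr0
  let t : Finset (Fin (n + 1)) → ℝ := fun C =>
    if C = Finset.univ then z else if C = {Fin.last n}ᶜ then r else C.card * a C
  have htu : t Finset.univ = z := if_pos rfl
  have hta : t {Fin.last n}ᶜ = r := (if_neg axis_ne_univ).trans (if_pos rfl)
  have ht0 : t ∅ = 0 := by
    have h2 : (∅ : Finset (Fin (n + 1))) ≠ Finset.univ := Finset.univ_nonempty.ne_empty.symm
    have h3 : (∅ : Finset (Fin (n + 1))) ≠ {Fin.last n}ᶜ := (axis_nonempty hn).ne_empty.symm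
    simp only [t]
    rw [if_neg h2, if_neg h3, hae, mul_zero]
  have htw : ∀ C, t C * faceWeight C = a C := by
    intro C
    by_cases hC : C = Finset.univ ∨ C = {Fin.last n}ᶜ
    · rw [faceWeight, if_pos hC, mul_zero, haxis]
      rcases hC with rfl | rfl
      · exact Finset.subset_univ _
      · exact subset_rfl
    · rw [faceWeight, if_neg hC]
      rw [not_or] at hC
      simp only [t]
      rw [if_neg hC.1, if_neg hC.2]
      rcases C.eq_empty_or_nonempty with rfl | hne
      · rw [hae, mul_zero, zero_mul]
      · have : (C.card : ℝ) ≠ 0 := by exact_mod_cast hne.card_pos.ne'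
        field_simp
  have hsum : ∑ C, t C • joinCoord C v = p := by
    rw [sum_smul_joinCoord]
    simp only [htw, has, hta, htu, Fin.snoc_castSucc, Fin.snoc_last]
    rw [sum_cycleWeight_smul, hx]
  refine ⟨v, t, ⟨fun C => ?_, ht0, ?_, ?_⟩, hsum⟩
  · simp only [t]
    split_ifs
    exacts [hz, hr, mul_nonneg C.card.cast_nonneg (ha0 C)]
  · rw [← sum_sum_smul_joinCoord ht0 v, hsum, h1]
  · intro C hC D hD _
    have key : ∀ C, t C ≠ 0 → C = Finset.univ ∨ (C = {Fin.last n}ᶜ ∧ r ≠ 0) ∨ a C ≠ 0 := by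
      intro C hC
      simp only [t] at hC
      split_ifs at hC with h1 h2
      · exact Or.inl h1
      · exact Or.inr (Or.inl ⟨h2, hC⟩)
      · exact Or.inr (Or.inr (right_ne_zero_of_mul hC))
    rcases key C hC with rfl | ⟨rfl, h1⟩ | h1
    · exact Or.inr (Finset.subset_univ D)
    · rcases key D hD with rfl | ⟨rfl, h2⟩ | h2
      · exact Or.inl (Finset.subset_univ _)
      · exact Or.inl subset_rfl
      · exact Or.inr (hrsub h1 D h2)
    · rcases key D hD with rfl | ⟨rfl, h2⟩ | h2
      · exact Or.inl (Finset.subset_univ _)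
      · exact Or.inl (hrsub h2 C h1)
      · exact hac.total h1 h2

/-- The linear map that realizes the PL homeomorphism from `|K(sphereGem n k)|` onto the sphere. -/
noncomputable def sphereMap (n k : ℕ) [NeZero k] :
    ((sphereGem n k).Cell → ℝ) →ₗ[ℝ] (Fin (n + 2) → ℝ) :=
  joinMap n ∘ₗ Fintype.linearCombination ℝ fun A : (sphereGem n k).Cell =>
    joinCoord A.colors ((sphereGem n k).exists_cell_eq A).choose

theorem sphereMap_facePoint (v : ZMod k × Bool) {t : Finset (Fin (n + 1)) → ℝ} (ht : t ∅ = 0) :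
    sphereMap n k ((sphereGem n k).facePoint v t) = joinMap n (∑ C, t C • joinCoord C v) := by
  rw [sphereMap, LinearMap.comp_apply, Fintype.linearCombination_apply]
  congr 1
  refine (sphereGem n k).sum_facePoint_smul v ht _ _ fun C hC => ?_
  exact joinCoord_congr ((cell_eq_cell_iff _).1
    ((sphereGem n k).exists_cell_eq ((sphereGem n k).cell C hC v)).choose_spec).2

theorem bijOn_sphereMap (hn : 1 ≤ n) :
    Set.BijOn (sphereMap n k) (sphereGem n k).toComplex.realization (plSphere n) := by
  refine ⟨fun x hx => ?_, fun x hx y hy hxy => ?_, fun y hy => ?_⟩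
  · obtain ⟨v, t, ht, rfl⟩ := (mem_realization_iff _ x).1 hx
    rw [sphereMap_facePoint v ht.empty]
    exact (ht.isJoinPoint hn v).joinMap_mem hn
      ((sum_sum_smul_joinCoord ht.empty v).trans ht.sum_eq)
  · obtain ⟨u, s, hs, rfl⟩ := (mem_realization_iff _ x).1 hx
    obtain ⟨v, t, ht, rfl⟩ := (mem_realization_iff _ y).1 hy
    rw [sphereMap_facePoint u hs.empty, sphereMap_facePoint v ht.empty] at hxy
    exact facePoint_eq_of_sum_smul_joinCoord_eq hs ht
      ((hs.isJoinPoint hn u).joinMap_inj hn (ht.isJoinPoint hn v) hxy)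
  · obtain ⟨p, hp, rfl⟩ := exists_joinMap_eq hn hy
    obtain ⟨v, t, ht, rfl⟩ :=
      exists_isFlagPoint_of_isJoinPoint hn k hp ((sum_joinMap hn p).symm.trans hy.1.2)
    exact ⟨_, (mem_realization_iff _ _).2 ⟨v, t, ht, rfl⟩, sphereMap_facePoint v ht.empty⟩

theorem isGem_sphereGem (hn : 1 ≤ n) (k : ℕ) [NeZero k] : (sphereGem n k).IsGem (plSphere n) :=
  plHomeomorphic_of_bijOn (ColoredComplex.isCompactPolyhedron_realization _) (sphereMap n k)
    (LinearMap.continuous_of_finiteDimensional (E := (sphereGem n k).Cell → ℝ) (sphereMap n k))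
    (bijOn_sphereMap hn)

end ColoredGraph

/-! ### Cones over the pieces of a piecewise-linear graph -/

section Pages

/-- The linear map projecting the boundary of a simplex, away from the face opposite to the vertex
`j`, onto that face: the vertex `j` goes to the barycenter of the face. -/
noncomputable def flatten {n : ℕ} (j : Fin (n + 2)) : (Fin (n + 2) → ℝ) →ₗ[ℝ] (Fin (n + 1) → ℝ) where
  toFun y i := y (j.succAbove i) + y j / (n + 1)
  map_add' y z := by
    funext i
    simp only [Pi.add_apply]
    ring
  map_smul' c y := by
    funext i
    simp only [Pi.smul_apply, smul_eq_mul, RingHom.id_apply]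
    ring

theorem flatten_inj {n : ℕ} {j : Fin (n + 2)} {y z : Fin (n + 2) → ℝ} (hy : ∀ i, 0 ≤ y i)
    (hz : ∀ i, 0 ≤ z i) (hy0 : ∃ i, y i = 0) (hz0 : ∃ i, z i = 0) (hyj : 0 < y j) (hzj : 0 < z j)
    (h : flatten j y = flatten j z) : y = z := by
  have hi : ∀ i, y (j.succAbove i) + y j / (n + 1) = z (j.succAbove i) + z j / (n + 1) := fun i =>
    congrFun h i
  have hj : y j / (n + 1) = z j / (n + 1) := by
    obtain ⟨a, ha⟩ := hy0
    obtain ⟨b, hb⟩ := hz0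
    obtain ⟨a, rfl⟩ := Fin.exists_succAbove_eq (show a ≠ j by rintro rfl; exact hyj.ne' ha)
    obtain ⟨b, rfl⟩ := Fin.exists_succAbove_eq (show b ≠ j by rintro rfl; exact hzj.ne' hb)
    have e1 := hi a
    have e2 := hi b
    have := hz (j.succAbove a)
    have := hy (j.succAbove b)
    linarith
  funext i
  by_cases hij : i = j
  · rw [hij]
    exact (div_left_inj' (by positivity)).1 hj
  · obtain ⟨i, rfl⟩ := Fin.exists_succAbove_eq hij
    have := hi i
    rw [hj] at this
    exact add_right_cancel this

/-- The point of the cone over a simplex with vertices `e_(A m)` that has coordinates `w`. -/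
noncomputable def simplexPoint {ι : Type*} [DecidableEq ι] {m : ℕ} (A : Fin m → ι) :
    (Fin m → ℝ) →ₗ[ℝ] (ι → ℝ) :=
  Fintype.linearCombination ℝ fun i => (Pi.single (A i) 1 : ι → ℝ)

theorem simplexPoint_apply_of_injective {ι : Type*} [DecidableEq ι] {m : ℕ} {A : Fin m → ι}
    (hA : Function.Injective A) (w : Fin m → ℝ) (i : Fin m) : simplexPoint A w (A i) = w i := by
  rw [simplexPoint, Fintype.linearCombination_apply, Finset.sum_apply,
    Finset.sum_eq_single i (fun j _ hj => ?_) (by simp)]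
  · simp
  · simp [hA.ne hj.symm]

theorem simplexPoint_apply_of_ne {ι : Type*} [DecidableEq ι] {m : ℕ} {A : Fin m → ι} {a : ι}
    (ha : ∀ i, A i ≠ a) (w : Fin m → ℝ) : simplexPoint A w a = 0 := by
  rw [simplexPoint, Fintype.linearCombination_apply, Finset.sum_apply]
  exact Finset.sum_eq_zero fun i _ => by simp [(ha i).symm]

/-- The cone over the convex hull of `s`. -/
noncomputable def hullCone {E : Type*} [AddCommGroup E] [Module ℝ E] (s : Finset E) :
    ConvexCone ℝ E :=
  ConvexCone.hull ℝ (convexHull ℝ (s : Set E))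

theorem mem_hullCone {E : Type*} [AddCommGroup E] [Module ℝ E] {s : Finset E} {p : E} :
    p ∈ hullCone s ↔ ∃ c : ℝ, 0 < c ∧ ∃ q ∈ convexHull ℝ (s : Set E), c • q = p := by
  rw [hullCone, ConvexCone.mem_hull_of_convex (convex_convexHull ℝ _)]
  rfl

theorem hullCone_smul_add_mem {E : Type*} [AddCommGroup E] [Module ℝ E] {s : Finset E} {p q : E}
    (hp : p ∈ hullCone s) (hq : q ∈ hullCone s) {a : ℝ} (ha : 0 ≤ a) :
    a • p + q ∈ hullCone s := by
  rcases ha.eq_or_lt with rfl | ha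
  · rwa [zero_smul, zero_add]
  · exact (hullCone s).add_mem ((hullCone s).smul_mem ha hp) hq

theorem hullCone_sum_mem {E : Type*} [AddCommGroup E] [Module ℝ E] {s : Finset E} {κ : Type*}
    {t : Finset κ} (ht : t.Nonempty) {p : κ → E} (hp : ∀ m ∈ t, p m ∈ hullCone s) {a : κ → ℝ}
    (ha : ∀ m ∈ t, 0 < a m) : ∑ m ∈ t, a m • p m ∈ hullCone s :=
  Finset.sum_induction_nonempty _ (· ∈ hullCone s) (fun _ _ h h' => (hullCone s).add_mem h h') ht
    fun m hm => (hullCone s).smul_mem (ha m hm) (hp m hm)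

/-- The cones over the pieces of `G` lie in the graph of the positively homogeneous extension of the
map with graph `G`, which is additive on each of them. -/
theorem exists_smul_eq_of_mem_hullCone {E : Type*} [AddCommGroup E] [Module ℝ E] {G : Set E}
    {S : Finset (Finset E)} (hS : G = ⋃ s ∈ S, convexHull ℝ (s : Set E)) {s : Finset E}
    (hs : s ∈ S) {p : E} (hp : p ∈ hullCone s) : ∃ c : ℝ, 0 < c ∧ ∃ q ∈ G, c • q = p := by
  obtain ⟨c, hc, q, hq, rfl⟩ := mem_hullCone.1 hp
  exact ⟨c, hc, q, hS ▸ Set.mem_biUnion hs hq, rfl⟩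

theorem mem_hullCone_of_smul_mem_fst {E F : Type*} [AddCommGroup E] [Module ℝ E] [AddCommGroup F]
    [Module ℝ F] {s : Finset (E × F)} {c : ℝ} (hc : 0 < c) {x : E}
    (h : c • x ∈ Prod.fst '' convexHull ℝ (s : Set (E × F))) : ∃ y, (x, y) ∈ hullCone s := by
  obtain ⟨⟨x', y⟩, hq, hx⟩ := h
  refine ⟨c⁻¹ • y, mem_hullCone.2 ⟨c⁻¹, inv_pos.2 hc, _, hq, ?_⟩⟩
  have hx' : x' = c • x := hx
  rw [hx', Prod.smul_mk, inv_smul_smul₀ hc.ne']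

variable {ι : Type*} {n : ℕ}

/-- By Baire's theorem, on some open set of points of a simplex the map with graph `G` is given on
a one-sided neighborhood of them in an adjacent simplex by one and the same piece. -/
theorem exists_isOpen_subset_hullCone [DecidableEq ι] (hn : 1 ≤ n)
    {G : Set ((ι → ℝ) × (Fin (n + 2) → ℝ))}
    {S : Finset (Finset ((ι → ℝ) × (Fin (n + 2) → ℝ)))}
    (hS : G = ⋃ s ∈ S, convexHull ℝ (s : Set ((ι → ℝ) × (Fin (n + 2) → ℝ))))
    {A : Fin n → ι} {a : ι}
    (hdom : ∀ (w : Fin n → ℝ) (t : ℝ), (∀ m, 0 < w m) → 0 ≤ t → ∑ m, w m + t = 1 →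
      ∃ y, (simplexPoint A w + t • Pi.single a 1, y) ∈ G)
    {U : Set (Fin n → ℝ)} (hU : IsOpen U) (hne : U.Nonempty) (hpos : ∀ w ∈ U, ∀ m, 0 < w m) :
    ∃ s ∈ S, ∃ τ : ℝ, 0 < τ ∧ ∃ U' ⊆ U, IsOpen U' ∧ U'.Nonempty ∧ ∀ w ∈ U',
      (∃ y, (simplexPoint A w, y) ∈ hullCone s) ∧
      ∃ y, (simplexPoint A w + τ • Pi.single a 1, y) ∈ hullCone s := by
  have hne' : (Finset.univ : Finset (Fin n)).Nonempty := ⟨⟨0, hn⟩, Finset.mem_univ _⟩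
  let P : S → Set (ι → ℝ) := fun s => Prod.fst '' convexHull ℝ (s.1 : Set ((ι → ℝ) × (Fin (n + 2) → ℝ)))
  have hP : ∀ s, IsClosed (P s) := fun s =>
    ((s.1.finite_toSet.isCompact_convexHull ℝ).image continuous_fst).isClosed
  -- the point of the adjacent simplex at height `t` over `w`, normalized
  let N : (Fin n → ℝ) → ℝ → (ι → ℝ) := fun w t =>
    (∑ m, w m + t)⁻¹ • (simplexPoint A w + t • Pi.single a 1)
  have hsum : ∀ w ∈ U, ∀ t : ℝ, 0 ≤ t → 0 < ∑ m, w m + t := fun w hw t ht =>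
    add_pos_of_pos_of_nonneg (Finset.sum_pos (fun m _ => hpos w hw m) hne') ht
  have hN : ∀ w ∈ U, ∀ t : ℝ, 0 ≤ t → ∃ s, N w t ∈ P s := by
    intro w hw t ht
    have hc := hsum w hw t ht
    obtain ⟨y, hy⟩ := hdom ((∑ m, w m + t)⁻¹ • w) ((∑ m, w m + t)⁻¹ * t)
      (fun m => mul_pos (inv_pos.2 hc) (hpos w hw m)) (mul_nonneg (inv_pos.2 hc).le ht) (by
        simp only [Pi.smul_apply, smul_eq_mul]
        rw [← Finset.mul_sum, ← mul_add, inv_mul_cancel₀ hc.ne'])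
    rw [hS] at hy
    obtain ⟨s, hs, hy⟩ := Set.mem_iUnion₂.1 hy
    refine ⟨⟨s, hs⟩, _, hy, ?_⟩
    simp only [N, map_smul, smul_add, smul_smul]
  have hcont : Continuous (simplexPoint A : (Fin n → ℝ) → (ι → ℝ)) :=
    LinearMap.continuous_of_finiteDimensional _
  have hNw : ∀ t : ℝ, 0 ≤ t → Continuous fun w : U => N w t := by
    intro t ht
    refine Continuous.smul (Continuous.inv₀ (by fun_prop) fun w : U => (hsum w w.2 t ht).ne') ?_
    exact (hcont.comp continuous_subtype_val).add continuous_const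
  let τ : ℕ → ℝ := fun m => 1 / ((m : ℝ) + 1)
  have hτ : ∀ m, 0 < τ m := fun m => by positivity
  let f : S × ℕ → Set U := fun i => {w | N w 0 ∈ P i.1 ∧ N w (τ i.2) ∈ P i.1}
  have hf : ∀ i, IsClosed (f i) := fun i =>
    ((hP i.1).preimage (hNw 0 le_rfl)).inter ((hP i.1).preimage (hNw _ (hτ i.2).le))
  have hcover : ⋃ i, f i = Set.univ := by
    refine Set.eq_univ_of_forall fun w => ?_
    choose g hg using fun m => hN w w.2 (τ m) (hτ m).le
    obtain ⟨s, hs⟩ := Finite.exists_infinite_fiber g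
    have hfreq : ∃ᶠ m in Filter.atTop, g m = s :=
      Nat.frequently_atTop_iff_infinite.2 (Set.infinite_coe_iff.1 hs)
    obtain ⟨m, hm⟩ := hfreq.exists
    refine Set.mem_iUnion.2 ⟨(s, m), ?_, hm ▸ hg m⟩
    refine (hP s).mem_of_frequently_of_tendsto (hfreq.mono fun m hm => hm ▸ hg m) ?_
    have hc0 : ContinuousAt (N w) 0 := by
      refine ContinuousAt.smul (ContinuousAt.inv₀ (by fun_prop) (hsum w w.2 0 le_rfl).ne') ?_
      fun_prop
    exact hc0.tendsto.comp tendsto_one_div_add_atTop_nhds_zero_nat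
  have : BaireSpace U := hU.baireSpace
  have : Nonempty U := hne.to_subtype
  obtain ⟨⟨s, m⟩, w₀, hw₀⟩ := nonempty_interior_of_iUnion_of_closed hf hcover
  refine ⟨s.1, s.2, τ m, hτ m, Subtype.val '' interior (f (s, m)), ?_,
    hU.isOpenMap_subtype_val _ isOpen_interior, ⟨_, w₀, hw₀, rfl⟩, ?_⟩
  · rintro _ ⟨w, -, rfl⟩
    exact w.2
  · rintro _ ⟨w, hw, rfl⟩
    obtain ⟨h1, h2⟩ := interior_subset hw
    constructor
    · refine mem_hullCone_of_smul_mem_fst (inv_pos.2 (hsum w w.2 0 le_rfl)) ?_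
      simpa only [N, zero_smul, add_zero] using h1
    · exact mem_hullCone_of_smul_mem_fst (inv_pos.2 (hsum w w.2 _ (hτ m).le)) h2

variable [Fintype ι]

/-- `G` is the graph of an injective map to the sphere, defined on a set of points with coordinate
sum one. -/
structure IsSphereGraph (G : Set ((ι → ℝ) × (Fin (n + 2) → ℝ))) : Prop where
  sum_fst : ∀ p ∈ G, ∑ i, p.1 i = 1
  snd_mem : ∀ p ∈ G, p.2 ∈ plSphere n
  snd_eq : ∀ p ∈ G, ∀ q ∈ G, p.1 = q.1 → p.2 = q.2
  fst_eq : ∀ p ∈ G, ∀ q ∈ G, p.2 = q.2 → p.1 = q.1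

namespace IsSphereGraph

variable {G : Set ((ι → ℝ) × (Fin (n + 2) → ℝ))}
  {S : Finset (Finset ((ι → ℝ) × (Fin (n + 2) → ℝ)))} {p q : (ι → ℝ) × (Fin (n + 2) → ℝ)}
  {s s' : Finset ((ι → ℝ) × (Fin (n + 2) → ℝ))}

theorem snd_nonneg_of_mem_hullCone (hG : IsSphereGraph G)
    (hS : G = ⋃ s ∈ S, convexHull ℝ (s : Set ((ι → ℝ) × (Fin (n + 2) → ℝ)))) (hs : s ∈ S)
    (hp : p ∈ hullCone s) (i : Fin (n + 2)) : 0 ≤ p.2 i := by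
  obtain ⟨c, hc, q, hq, rfl⟩ := exists_smul_eq_of_mem_hullCone hS hs hp
  exact mul_nonneg hc.le ((hG.snd_mem q hq).1.1 i)

theorem exists_snd_eq_zero_of_mem_hullCone (hG : IsSphereGraph G)
    (hS : G = ⋃ s ∈ S, convexHull ℝ (s : Set ((ι → ℝ) × (Fin (n + 2) → ℝ)))) (hs : s ∈ S)
    (hp : p ∈ hullCone s) : ∃ i, p.2 i = 0 := by
  obtain ⟨c, hc, q, hq, rfl⟩ := exists_smul_eq_of_mem_hullCone hS hs hp
  obtain ⟨i, hi⟩ := (hG.snd_mem q hq).2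
  exact ⟨i, by simp [hi]⟩

theorem exists_snd_pos_of_mem_hullCone (hG : IsSphereGraph G)
    (hS : G = ⋃ s ∈ S, convexHull ℝ (s : Set ((ι → ℝ) × (Fin (n + 2) → ℝ)))) (hs : s ∈ S)
    (hp : p ∈ hullCone s) : ∃ i, 0 < p.2 i := by
  obtain ⟨c, hc, q, hq, rfl⟩ := exists_smul_eq_of_mem_hullCone hS hs hp
  obtain ⟨⟨h0, h1⟩, -⟩ := hG.snd_mem q hq
  by_contra! h
  have : ∑ i, q.2 i ≤ 0 := Finset.sum_nonpos fun i _ => by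
    have : c * q.2 i ≤ 0 := h i
    nlinarith [h0 i]
  linarith

theorem snd_eq_of_mem_hullCone (hG : IsSphereGraph G)
    (hS : G = ⋃ s ∈ S, convexHull ℝ (s : Set ((ι → ℝ) × (Fin (n + 2) → ℝ)))) (hs : s ∈ S)
    (hs' : s' ∈ S) (hp : p ∈ hullCone s) (hq : q ∈ hullCone s') (h : p.1 = q.1) : p.2 = q.2 := by
  obtain ⟨c, hc, p, hpG, rfl⟩ := exists_smul_eq_of_mem_hullCone hS hs hp
  obtain ⟨d, hd, q, hqG, rfl⟩ := exists_smul_eq_of_mem_hullCone hS hs' hq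
  have hcd : c = d := by
    have := congrArg (fun x => ∑ i, x i) h
    simpa [← Finset.mul_sum, hG.sum_fst p hpG, hG.sum_fst q hqG] using this
  subst hcd
  have h' : p.1 = q.1 := smul_right_injective _ hc.ne' h
  simp [hG.snd_eq p hpG q hqG h']

theorem fst_eq_of_mem_hullCone (hG : IsSphereGraph G)
    (hS : G = ⋃ s ∈ S, convexHull ℝ (s : Set ((ι → ℝ) × (Fin (n + 2) → ℝ)))) (hs : s ∈ S)
    (hs' : s' ∈ S) (hp : p ∈ hullCone s) (hq : q ∈ hullCone s') (h : p.2 = q.2) : p.1 = q.1 := by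
  obtain ⟨c, hc, p, hpG, rfl⟩ := exists_smul_eq_of_mem_hullCone hS hs hp
  obtain ⟨d, hd, q, hqG, rfl⟩ := exists_smul_eq_of_mem_hullCone hS hs' hq
  have hcd : c = d := by
    have := congrArg (fun x => ∑ i, x i) h
    simpa [← Finset.mul_sum, (hG.snd_mem p hpG).1.2, (hG.snd_mem q hqG).1.2] using this
  subst hcd
  have h' : p.2 = q.2 := smul_right_injective _ hc.ne' h
  simp [hG.fst_eq p hpG q hqG h']

end IsSphereGraph

/-! ### Three simplices with a common face do not embed in the sphere -/

/-- Of three real numbers, two lie weakly on the same side of `0`: they have a nontrivial relation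
with nonnegative coefficients. -/
theorem exists_mul_eq_mul_of_fin_three (x : Fin 3 → ℝ) : ∃ i j : Fin 3, i ≠ j ∧
    ∃ a b : ℝ, 0 ≤ a ∧ 0 ≤ b ∧ (a ≠ 0 ∨ b ≠ 0) ∧ a * x i = b * x j := by
  have key : ∀ i j : Fin 3, i ≠ j → 0 ≤ x i * x j → ∃ i j : Fin 3, i ≠ j ∧
      ∃ a b : ℝ, 0 ≤ a ∧ 0 ≤ b ∧ (a ≠ 0 ∨ b ≠ 0) ∧ a * x i = b * x j := by
    intro i j hij h
    by_cases hi : x i = 0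
    · exact ⟨i, j, hij, 1, 0, zero_le_one, le_rfl, Or.inl one_ne_zero, by rw [hi]; ring⟩
    · refine ⟨i, j, hij, |x j|, |x i|, abs_nonneg _, abs_nonneg _, Or.inr (abs_ne_zero.2 hi), ?_⟩
      rcases mul_nonneg_iff.1 h with ⟨h1, h2⟩ | ⟨h1, h2⟩
      · rw [abs_of_nonneg h1, abs_of_nonneg h2, mul_comm]
      · rw [abs_of_nonpos h1, abs_of_nonpos h2]
        ring
  by_contra h
  have h1 : x 0 * x 1 < 0 := by
    by_contra h'
    exact h (key 0 1 (by decide) (not_lt.1 h'))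
  have h2 : x 1 * x 2 < 0 := by
    by_contra h'
    exact h (key 1 2 (by decide) (not_lt.1 h'))
  have h3 : x 0 * x 2 < 0 := by
    by_contra h'
    exact h (key 0 2 (by decide) (not_lt.1 h'))
  nlinarith [mul_pos (mul_pos_of_neg_of_neg h1 h2) (neg_pos.2 h3), mul_self_nonneg (x 0 * x 1 * x 2)]

/-- A linear functional vanishing exactly on the span of `n` independent vectors of `ℝ^(n+1)`. -/
theorem exists_ker_eq_span {Y : Fin n → Fin (n + 1) → ℝ} (hY : LinearIndependent ℝ Y) :
    ∃ f : (Fin (n + 1) → ℝ) →ₗ[ℝ] ℝ, LinearMap.ker f = Submodule.span ℝ (Set.range Y) := by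
  have h1 : Module.finrank ℝ (Submodule.span ℝ (Set.range Y)) = n := by
    rw [finrank_span_eq_card hY, Fintype.card_fin]
  have h2 := Submodule.finrank_quotient_add_finrank (Submodule.span ℝ (Set.range Y))
  rw [h1, Module.finrank_fin_fun] at h2
  have e := LinearEquiv.ofFinrankEq ((Fin (n + 1) → ℝ) ⧸ Submodule.span ℝ (Set.range Y)) ℝ
    (by rw [Module.finrank_self]; omega)
  exact ⟨e.toLinearMap ∘ₗ Submodule.mkQ _, by rw [LinearEquiv.ker_comp, Submodule.ker_mkQ]⟩

/-- Three `n`-simplices with a common `(n-1)`-face do not embed piecewise linearly into the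
`n`-sphere. Near a generic point of the common face the embedding is linear on each of them, and in a
flat chart the images of two of them lie on the same side of the image of the common face, so that
they overlap. -/
theorem IsSphereGraph.not_three_pages [DecidableEq ι] (hn : 1 ≤ n)
    {G : Set ((ι → ℝ) × (Fin (n + 2) → ℝ))} (hG : IsSphereGraph G) (hpoly : IsCompactPolyhedron G)
    {A : Fin n → ι} (hA : Function.Injective A) {σ : Fin 3 → ι} (hσ : Function.Injective σ)
    (hAσ : ∀ m i, A m ≠ σ i)
    (hdom : ∀ i (w : Fin n → ℝ) (t : ℝ), (∀ m, 0 < w m) → 0 ≤ t → ∑ m, w m + t = 1 →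
      ∃ y, (simplexPoint A w + t • Pi.single (σ i) 1, y) ∈ G) : False := by
  obtain ⟨S, hS⟩ := hpoly
  obtain ⟨s0, hs0, τ0, hτ0, U0, hU0, hU0o, hU0n, h0⟩ :=
    exists_isOpen_subset_hullCone hn hS (hdom 0) (U := {w | ∀ m, 0 < w m})
      (by
        simp only [Set.ofPred_forall]
        exact isOpen_iInter_of_finite fun m => isOpen_lt continuous_const (continuous_apply m))
      ⟨fun _ => 1, fun _ => one_pos⟩ fun w hw => hw
  obtain ⟨s1, hs1, τ1, hτ1, U1, hU1, hU1o, hU1n, h1⟩ :=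
    exists_isOpen_subset_hullCone hn hS (hdom 1) hU0o hU0n fun w hw => hU0 hw
  obtain ⟨s2, hs2, τ2, hτ2, U, hU, hUo, hUn, h2⟩ :=
    exists_isOpen_subset_hullCone hn hS (hdom 2) hU1o hU1n fun w hw => hU0 (hU1 hw)
  obtain ⟨s, τ, hs, hτ, hw1, hw2⟩ : ∃ (s : Fin 3 → Finset ((ι → ℝ) × (Fin (n + 2) → ℝ)))
      (τ : Fin 3 → ℝ), (∀ i, s i ∈ S) ∧ (∀ i, 0 < τ i) ∧
      (∀ w ∈ U, ∀ i, ∃ y, (simplexPoint A w, y) ∈ hullCone (s i)) ∧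
      ∀ w ∈ U, ∀ i, ∃ y, (simplexPoint A w + τ i • Pi.single (σ i) 1, y) ∈ hullCone (s i) := by
    refine ⟨![s0, s1, s2], ![τ0, τ1, τ2], fun i => ?_, fun i => ?_, fun w hw i => ?_,
      fun w hw i => ?_⟩ <;> fin_cases i
    exacts [hs0, hs1, hs2, hτ0, hτ1, hτ2, (h0 w (hU1 (hU hw))).1, (h1 w (hU hw)).1, (h2 w hw).1,
      (h0 w (hU1 (hU hw))).2, (h1 w (hU hw)).2, (h2 w hw).2]
  -- a basis of `ℝⁿ` contained in the open set `U`
  obtain ⟨p, hp⟩ := hUn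
  obtain ⟨δ, hδ, hb⟩ : ∃ δ : ℝ, 0 < δ ∧ ∀ m, p + δ • Pi.single m 1 ∈ U := by
    obtain ⟨ε, hε, hball⟩ := Metric.isOpen_iff.1 hUo p hp
    refine ⟨ε / 2, by positivity, fun m => hball ?_⟩
    rw [mem_ball_iff_norm, add_sub_cancel_left, norm_smul, Pi.norm_single, norm_one, mul_one,
      Real.norm_of_nonneg (by positivity)]
    linarith
  have hppos : ∀ m, 0 < p m := hU0 (hU1 (hU hp))
  set b : Fin n → Fin n → ℝ := fun m => p + δ • Pi.single m 1 with hbdef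
  have hbind : ∀ v : Fin n → ℝ, ∑ m, v m • b m = 0 → v = 0 := by
    intro v hv
    have hcoord : ∀ i, (∑ m, v m) * p i + δ * v i = 0 := by
      intro i
      have := congrFun hv i
      simp only [hbdef, Finset.sum_apply, Pi.smul_apply, Pi.add_apply, smul_eq_mul, mul_add,
        Finset.sum_add_distrib, Pi.zero_apply, ← Finset.sum_mul, Pi.single_apply, mul_ite, mul_one,
        mul_zero, Finset.sum_ite_eq, Finset.mem_univ, if_true] at this
      linarith
    have hsum : (∑ m, v m) * (∑ m, p m + δ) = 0 := by
      have := Finset.sum_eq_zero fun i (_ : i ∈ Finset.univ) => hcoord i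
      rw [Finset.sum_add_distrib, ← Finset.mul_sum, ← Finset.mul_sum] at this
      linarith
    have h0 : ∑ m, v m = 0 := (mul_eq_zero.1 hsum).resolve_right
      (add_pos_of_nonneg_of_pos (Finset.sum_nonneg fun m _ => (hppos m).le) hδ).ne'
    funext i
    have := hcoord i
    rw [h0, zero_mul, zero_add] at this
    exact (mul_eq_zero.1 this).resolve_left hδ.ne'
  choose Y hY using fun m => hw1 (b m) (hb m) 0
  have hYi : ∀ i m, (simplexPoint A (b m), Y m) ∈ hullCone (s i) := by
    intro i m
    obtain ⟨y, hy⟩ := hw1 (b m) (hb m) i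
    have : y = Y m := hG.snd_eq_of_mem_hullCone hS (hs i) (hs 0) hy (hY m) rfl
    rwa [this] at hy
  choose W hW using hw2 p hp
  have m₀ : Fin n := ⟨0, hn⟩
  obtain ⟨j, hj⟩ := hG.exists_snd_pos_of_mem_hullCone hS (hs 0) (hY m₀)
  have hYnonneg : ∀ m l, 0 ≤ Y m l := fun m =>
    hG.snd_nonneg_of_mem_hullCone hS (hs 0) (hY m)
  have hWnonneg : ∀ i l, 0 ≤ W i l := fun i =>
    hG.snd_nonneg_of_mem_hullCone hS (hs i) (hW i)
  -- positive combinations of the `b m`, moved into one of the three simplices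
  have hmem : ∀ i (a : ℝ) (v : Fin n → ℝ), 0 ≤ a → (∀ m, 0 < v m) →
      (a • (simplexPoint A p + τ i • Pi.single (σ i) 1) + simplexPoint A (∑ m, v m • b m),
        a • W i + ∑ m, v m • Y m) ∈ hullCone (s i) := by
    intro i a v ha hv
    have := hullCone_smul_add_mem (hW i) (hullCone_sum_mem (t := Finset.univ)
      ⟨m₀, Finset.mem_univ _⟩ (fun m _ => hYi i m) fun m _ => hv m) ha
    convert this using 1
    refine Prod.ext ?_ ?_
    · simp [Prod.fst_sum]
    · simp [Prod.snd_sum]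
  have hpos : ∀ i (a : ℝ) (v : Fin n → ℝ), 0 ≤ a → (∀ m, 0 < v m) →
      0 < (a • W i + ∑ m, v m • Y m) j := by
    intro i a v ha hv
    rw [Pi.add_apply, Finset.sum_apply]
    refine add_pos_of_nonneg_of_pos (mul_nonneg ha (hWnonneg i j)) ?_
    exact Finset.sum_pos' (fun m _ => mul_nonneg (hv m).le (hYnonneg m j))
      ⟨m₀, Finset.mem_univ _, mul_pos (hv m₀) hj⟩
  have hinj : ∀ (i i' : Fin 3) (a a' : ℝ) (v v' : Fin n → ℝ), 0 ≤ a → 0 ≤ a' → (∀ m, 0 < v m) →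
      (∀ m, 0 < v' m) →
      flatten j (a • W i + ∑ m, v m • Y m) = flatten j (a' • W i' + ∑ m, v' m • Y m) →
      a • (simplexPoint A p + τ i • Pi.single (σ i) 1) + simplexPoint A (∑ m, v m • b m) =
        a' • (simplexPoint A p + τ i' • Pi.single (σ i') 1) +
          simplexPoint A (∑ m, v' m • b m) := by
    intro i i' a a' v v' ha ha' hv hv' h
    have m1 := hmem i a v ha hv
    have m2 := hmem i' a' v' ha' hv'
    refine hG.fst_eq_of_mem_hullCone hS (hs i) (hs i') m1 m2 ?_
    exact flatten_inj (hG.snd_nonneg_of_mem_hullCone hS (hs i) m1)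
      (hG.snd_nonneg_of_mem_hullCone hS (hs i') m2)
      (hG.exists_snd_eq_zero_of_mem_hullCone hS (hs i) m1)
      (hG.exists_snd_eq_zero_of_mem_hullCone hS (hs i') m2)
      (hpos i a v ha hv) (hpos i' a' v' ha' hv') h
  -- splitting a real vector as a difference of positive ones
  have hsplit : ∀ (v : Fin n → ℝ) m, v m = (max (v m) 0 + 1) - (max (-v m) 0 + 1) := fun v m => by
    rw [add_sub_add_right_eq_sub, max_zero_sub_max_neg_zero_eq_self]
  have hpos' : ∀ x : ℝ, 0 < max x 0 + 1 := fun x =>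
    add_pos_of_nonneg_of_pos (le_max_right _ _) one_pos
  have hind : LinearIndependent ℝ fun m => flatten j (Y m) := by
    rw [Fintype.linearIndependent_iff]
    intro v hv
    have hsum : ∑ m, v m • Y m =
        ∑ m, (max (v m) 0 + 1) • Y m - ∑ m, (max (-v m) 0 + 1) • Y m := by
      rw [← Finset.sum_sub_distrib]
      exact Finset.sum_congr rfl fun m _ => by rw [← sub_smul, ← hsplit]
    have h := hinj 0 0 0 0 (fun m => max (v m) 0 + 1) (fun m => max (-v m) 0 + 1) le_rfl le_rfl
      (fun m => hpos' _) (fun m => hpos' _) (by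
        rw [zero_smul, zero_add, zero_add, ← sub_eq_zero, ← map_sub, ← hsum, map_sum]
        simpa using hv)
    rw [zero_smul, zero_add, zero_add] at h
    have hA' : Function.Injective (simplexPoint A) := by
      intro x y hxy
      funext i
      rw [← simplexPoint_apply_of_injective hA x, hxy, simplexPoint_apply_of_injective hA]
    have hv0 := hbind v (by
      rw [← sub_eq_zero.2 (hA' h), ← Finset.sum_sub_distrib]
      exact Finset.sum_congr rfl fun m _ => by rw [← sub_smul, ← hsplit])
    exact fun i => congrFun hv0 i
  obtain ⟨f, hf⟩ := exists_ker_eq_span hind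
  obtain ⟨i, i', hii', a, a', ha, ha', hne, haa'⟩ :=
    exists_mul_eq_mul_of_fin_three fun i => f (flatten j (W i))
  have hker : flatten j (a' • W i' - a • W i) ∈ LinearMap.ker f := by
    rw [LinearMap.mem_ker, map_sub, map_sub, map_smul, map_smul, map_smul, map_smul, smul_eq_mul,
      smul_eq_mul, haa', sub_self]
  rw [hf, Submodule.mem_span_range_iff_exists_fun] at hker
  obtain ⟨v, hv⟩ := hker
  have h := hinj i i' a a' (fun m => max (v m) 0 + 1) (fun m => max (-v m) 0 + 1) ha ha'
    (fun m => hpos' _) (fun m => hpos' _) (by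
      have hsum : ∑ m, v m • Y m =
          ∑ m, (max (v m) 0 + 1) • Y m - ∑ m, (max (-v m) 0 + 1) • Y m := by
        rw [← Finset.sum_sub_distrib]
        exact Finset.sum_congr rfl fun m _ => by rw [← sub_smul, ← hsplit]
      have hv' : flatten j (∑ m, v m • Y m) = flatten j (a' • W i' - a • W i) := by
        rw [← hv, map_sum]
        simp
      rw [hsum, map_sub, map_sub, sub_eq_sub_iff_add_eq_add] at hv'
      rw [map_add, map_add]
      exact (add_comm _ _).trans hv')
  have hzero : ∀ l w, simplexPoint A w (σ l) = 0 := fun l w =>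
    simplexPoint_apply_of_ne (fun m => hAσ m l) w
  have e1 := congrFun h (σ i)
  have e2 := congrFun h (σ i')
  simp only [Pi.add_apply, Pi.smul_apply, hzero, Pi.single_eq_same, Pi.single_eq_of_ne (hσ.ne hii'),
    Pi.single_eq_of_ne (hσ.ne hii'.symm), smul_eq_mul, mul_one, mul_zero, add_zero, zero_add,
    mul_eq_zero, zero_eq_mul, (hτ _).ne', or_false] at e1 e2
  rcases hne with hne | hne
  · exact hne e1
  · exact hne e2

end Pages

/-! ### Ridges of a triangulated sphere -/

theorem sum_simplexPoint {ι : Type*} [Fintype ι] [DecidableEq ι] {m : ℕ} (A : Fin m → ι)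
    (w : Fin m → ℝ) : ∑ a, simplexPoint A w a = ∑ i, w i := by
  simp only [simplexPoint, Fintype.linearCombination_apply, Finset.sum_apply]
  rw [Finset.sum_comm]
  simp [← Finset.mul_sum]

theorem simplexPoint_nonneg {ι : Type*} [DecidableEq ι] {m : ℕ} (A : Fin m → ι) {w : Fin m → ℝ}
    (hw : ∀ i, 0 ≤ w i) (a : ι) : 0 ≤ simplexPoint A w a := by
  simp only [simplexPoint, Fintype.linearCombination_apply, Finset.sum_apply, Pi.smul_apply,
    smul_eq_mul]
  refine Finset.sum_nonneg fun i _ => mul_nonneg (hw i) ?_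
  rw [Pi.single_apply]
  split_ifs <;> norm_num

namespace ColoredComplex

variable {n : ℕ}

/-- A maximal flag of faces of a ridge. -/
theorem exists_flag (K : ColoredComplex n) (ρ : K.Ridge) :
    ∃ A : Fin n → K.Face, Function.Injective A ∧ (∀ i j, i ≤ j → A i ≤ A j) ∧ ∀ i, A i ≤ ρ.1 := by
  classical
  let e : Fin n ≃ K.color ρ.1 := (Finset.equivFinOfCardEq ρ.2).symm
  let C : Fin n → Finset (Fin (n + 1)) := fun m =>
    (Finset.univ.filter (· ≤ m)).image fun i => (e i : Fin (n + 1))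
  have hmem : ∀ i m, (e i : Fin (n + 1)) ∈ C m ↔ i ≤ m := by
    intro i m
    simp [C]
  have hsub : ∀ m, C m ⊆ K.color ρ.1 := by
    intro m c hc
    obtain ⟨i, -, rfl⟩ := Finset.mem_image.1 hc
    exact (e i).2
  have hne : ∀ m, (C m).Nonempty := fun m => ⟨e m, (hmem m m).2 le_rfl⟩
  have hex := fun m => K.existsUnique_face ρ.1 (C m) (hne m) (hsub m)
  choose A hA hAu using hex
  refine ⟨A, fun i j hij => ?_, fun i j hij => ?_, fun i => (hA i).1⟩
  · have hC : C i = C j := by rw [← (hA i).2, ← (hA j).2, hij]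
    refine le_antisymm ((hmem i j).1 ?_) ((hmem j i).1 ?_)
    · rw [← hC]
      exact (hmem i i).2 le_rfl
    · rw [hC]
      exact (hmem j j).2 le_rfl
  · have hCij : C i ⊆ C j :=
      Finset.image_subset_image (Finset.monotone_filter_right _ fun _ _ h => h.trans hij)
    obtain ⟨B, ⟨hB1, hB2⟩, -⟩ := K.existsUnique_face (A j) (C i) (hne i) ((hA j).2.symm ▸ hCij)
    rw [← hAu i B ⟨hB1.trans (hA j).1, hB2⟩]
    exact hB1

open Classical in
/-- In a complex whose polyhedron is PL homeomorphic to the `n`-sphere, every `(n-1)`-simplex lies in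
at most two `n`-simplices. -/
theorem card_facets_le_two (hn : 1 ≤ n) {K : ColoredComplex n}
    (hK : PLHomeomorphic K.realization (plSphere n)) (ρ : K.Ridge) :
    (Finset.univ.filter fun σ : K.Facet => ρ.1 ≤ σ.1).card ≤ 2 := by
  obtain ⟨h, hpoly⟩ := hK
  by_contra! hcard
  obtain ⟨σ₀, σ₁, σ₂, h0, h1, h2, h01, h02, h12⟩ := Finset.two_lt_card_iff.1 hcard
  let σ : Fin 3 → K.Face := ![σ₀, σ₁, σ₂]
  have hσρ : ∀ i, ρ.1 ≤ σ i := by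
    intro i
    fin_cases i
    exacts [(Finset.mem_filter.1 h0).2, (Finset.mem_filter.1 h1).2, (Finset.mem_filter.1 h2).2]
  have hσc : ∀ i, K.color (σ i) = Finset.univ := by
    intro i
    fin_cases i
    exacts [σ₀.2, σ₁.2, σ₂.2]
  have hσ : Function.Injective σ := by
    have e1 : σ 0 ≠ σ 1 := fun h => h01 (Subtype.ext h)
    have e2 : σ 0 ≠ σ 2 := fun h => h02 (Subtype.ext h)
    have e3 : σ 1 ≠ σ 2 := fun h => h12 (Subtype.ext h)
    intro i j hij
    fin_cases i <;> fin_cases j <;>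
      first | rfl | exact absurd hij e1 | exact absurd hij e2 | exact absurd hij e3 |
        exact absurd hij e1.symm | exact absurd hij e2.symm | exact absurd hij e3.symm
  obtain ⟨A, hA, hmono, hAρ⟩ := K.exists_flag ρ
  have hAσ : ∀ m i, A m ≠ σ i := by
    intro m i hmi
    have hc := Finset.card_le_card (K.color_mono _ _ (hAρ m))
    rw [hmi, hσc i, ρ.2, Finset.card_univ, Fintype.card_fin] at hc
    omega
  refine IsSphereGraph.not_three_pages hn (G := Set.range fun x : K.realization =>
    ((x : K.Face → ℝ), (h x : Fin (n + 2) → ℝ))) ⟨?_, ?_, ?_, ?_⟩ hpoly hA hσ hAσ ?_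
  · rintro _ ⟨x, rfl⟩
    exact x.2.2.1
  · rintro _ ⟨x, rfl⟩
    exact (h x).2
  · rintro _ ⟨x, rfl⟩ _ ⟨y, rfl⟩ hxy
    simp only at hxy ⊢
    rw [Subtype.ext hxy]
  · rintro _ ⟨x, rfl⟩ _ ⟨y, rfl⟩ hxy
    simp only at hxy ⊢
    rw [h.injective (Subtype.ext hxy)]
  · intro i w t hw ht hsum
    refine ⟨_, ⟨_, fun a => ?_, ?_, ?_⟩, rfl⟩
    · refine add_nonneg (simplexPoint_nonneg A (fun m => (hw m).le) a) (mul_nonneg ht ?_)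
      rw [Pi.single_apply]
      split_ifs <;> norm_num
    · simpa [Finset.sum_add_distrib, sum_simplexPoint, ← Finset.mul_sum] using hsum
    · have hsupp : ∀ a, (simplexPoint A w + t • (Pi.single (σ i) 1 : K.Face → ℝ)) a ≠ 0 →
          (∃ m, A m = a) ∨ a = σ i := by
        intro a ha
        by_contra! hne
        refine ha ?_
        rw [Pi.add_apply, simplexPoint_apply_of_ne hne.1, Pi.smul_apply,
          Pi.single_eq_of_ne hne.2, smul_zero, add_zero]
      intro a ha b hb _
      rcases hsupp a ha with ⟨l, rfl⟩ | rfl <;> rcases hsupp b hb with ⟨m, rfl⟩ | rfl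
      · exact (le_total l m).imp (hmono l m) (hmono m l)
      · exact Or.inl ((hAρ l).trans (hσρ i))
      · exact Or.inr ((hAρ m).trans (hσρ i))
      · exact Or.inl le_rfl

/-! ### Fundamental classes -/

open Classical in
/-- Since the faces of facets opposite to vertices of the same color occur with the same sign in the
boundary, a chain is a cycle if its coefficients around every ridge add up to zero. -/
theorem mem_topHomology_iff {K : ColoredComplex n} {a : K.Facet → ℤ} :
    a ∈ K.topHomology ↔ ∀ ρ : K.Ridge, ∑ σ : K.Facet with ρ.1 ≤ σ.1, a σ = 0 := by
  rw [topHomology, LinearMap.mem_ker, funext_iff]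
  refine forall_congr' fun ρ => ?_
  obtain ⟨i, hi⟩ : ∃ i, K.color ρ.1 = {i}ᶜ := by
    have : (K.color ρ.1)ᶜ.card = 1 := by
      rw [Finset.card_compl, ρ.2, Fintype.card_fin]
      omega
    obtain ⟨i, hi⟩ := Finset.card_eq_one.1 this
    exact ⟨i, by rw [← hi, compl_compl]⟩
  have hb : K.boundary a ρ = (-1) ^ (i : ℕ) * ∑ σ : K.Facet with ρ.1 ≤ σ.1, a σ := by
    change ∑ σ : K.Facet, ∑ j : Fin (n + 1), (if ρ.1 ≤ σ.1 ∧ K.color ρ.1 = {j}ᶜ then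
      (-1) ^ (j : ℕ) * a σ else 0) = _
    rw [Finset.mul_sum, Finset.sum_filter]
    refine Finset.sum_congr rfl fun σ _ => ?_
    rw [Finset.sum_eq_single i]
    · simp [hi]
    · rintro j - hj
      rw [if_neg]
      rintro ⟨-, h⟩
      rw [hi, compl_inj_iff, Finset.singleton_inj] at h
      exact hj h.symm
    · simp
  rw [hb, Pi.zero_apply, mul_eq_zero]
  exact or_iff_right (pow_ne_zero _ (by norm_num))

/-- The facets with nonzero coefficient in a cycle do not come alone. -/
theorem exists_ne_of_mem_topHomology (hn : 1 ≤ n) {K : ColoredComplex n} {a : K.Facet → ℤ}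
    (ha : a ∈ K.topHomology) {σ : K.Facet} (hσ : a σ ≠ 0) : ∃ τ, τ ≠ σ ∧ a τ ≠ 0 := by
  classical
  have hcard : ({0}ᶜ : Finset (Fin (n + 1))).card = n := by simp [Finset.card_compl]
  obtain ⟨B, ⟨hB, hBc⟩, -⟩ := K.existsUnique_face σ.1 {0}ᶜ (Finset.card_pos.1 (by omega))
    (by rw [σ.2]; exact Finset.subset_univ _)
  have := mem_topHomology_iff.1 ha ⟨B, by rw [hBc, hcard]⟩
  by_contra! h
  rw [Finset.sum_eq_single_of_mem σ (by simpa using hB) fun τ _ hτ => h τ hτ] at this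
  exact hσ this

/-- If no ridge lies in more than two facets, then the signs of the coefficients of a cycle form a
cycle; so the coefficients of a generator of the group of cycles are at most one in absolute value. -/
theorem IsFundamentalClass.natAbs_le_one {K : ColoredComplex n} {a : K.Facet → ℤ}
    (ha : K.IsFundamentalClass a)
    (hK : ∀ ρ : K.Ridge, ∃ s : Finset K.Facet, s.card ≤ 2 ∧ ∀ σ : K.Facet, σ ∈ s ↔ ρ.1 ≤ σ.1)
    (σ : K.Facet) : (a σ).natAbs ≤ 1 := by
  classical
  have hmem : a ∈ K.topHomology := ha.2 ▸ Submodule.mem_span_singleton_self a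
  have hsign : (fun σ => (a σ).sign) ∈ K.topHomology := by
    rw [mem_topHomology_iff] at hmem ⊢
    intro ρ
    obtain ⟨s, hs, hsρ⟩ := hK ρ
    have hfil : (Finset.univ.filter fun σ : K.Facet => ρ.1 ≤ σ.1) = s := by
      ext σ
      simp [hsρ]
    have h := hmem ρ
    rw [hfil] at h ⊢
    interval_cases hc : s.card
    · rw [Finset.card_eq_zero.1 hc, Finset.sum_empty]
    · obtain ⟨x, rfl⟩ := Finset.card_eq_one.1 hc
      rw [Finset.sum_singleton] at h ⊢
      rw [h, Int.sign_zero]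
    · obtain ⟨x, y, hxy, rfl⟩ := Finset.card_eq_two.1 hc
      rw [Finset.sum_pair hxy] at h ⊢
      rw [eq_neg_of_add_eq_zero_left h, Int.sign_neg, neg_add_cancel]
  rw [ha.2, Submodule.mem_span_singleton] at hsign
  obtain ⟨m, hm⟩ := hsign
  have hmσ : m * a σ = (a σ).sign := congrFun hm σ
  by_cases h0 : a σ = 0
  · simp [h0]
  · have := congrArg Int.natAbs hmσ
    rw [Int.natAbs_mul, Int.natAbs_sign_of_ne_zero h0] at this
    exact (Nat.eq_one_of_mul_eq_one_left this).le

theorem IsFundamentalClass.exists_ne (hn : 1 ≤ n) {K : ColoredComplex n} {a : K.Facet → ℤ}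
    (ha : K.IsFundamentalClass a) : ∃ σ τ, σ ≠ τ ∧ a σ ≠ 0 ∧ a τ ≠ 0 := by
  obtain ⟨σ, hσ⟩ := Function.ne_iff.1 ha.1
  obtain ⟨τ, hτ, hτ'⟩ := exists_ne_of_mem_topHomology hn
    (ha.2 ▸ Submodule.mem_span_singleton_self a) hσ
  exact ⟨σ, τ, hτ.symm, hσ, hτ'⟩

theorem IsFundamentalClass.two_le_numFacets (hn : 1 ≤ n) {K : ColoredComplex n} {a : K.Facet → ℤ}
    (ha : K.IsFundamentalClass a) : 2 ≤ K.numFacets := by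
  obtain ⟨σ, τ, hστ, -, -⟩ := ha.exists_ne hn
  exact Fintype.one_lt_card_iff.2 ⟨σ, τ, hστ⟩

namespace SimplicialMap

theorem natAbs_facetSign_le_one {K L : ColoredComplex n} (f : SimplicialMap K L) (σ : K.Facet) :
    (f.facetSign σ).natAbs ≤ 1 := by
  classical
  unfold facetSign
  split_ifs
  · exact (Int.units_natAbs _).le
  · exact Nat.zero_le _

/-- A degree `d` map hits each facet of the support of the fundamental class of the target at least
`|d|` times. -/
theorem HasDegree.two_mul_natAbs_le_numFacets (hn : 1 ≤ n) {K L : ColoredComplex n}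
    {f : SimplicialMap K L} {a : K.Facet → ℤ} {b : L.Facet → ℤ} {d : ℤ} (h : f.HasDegree a b d)
    (hK : PLHomeomorphic K.realization (plSphere n)) : 2 * d.natAbs ≤ K.numFacets := by
  classical
  obtain ⟨ha, hb, hab⟩ := h
  obtain ⟨σ, τ, hστ, hσ, hτ⟩ := hb.exists_ne hn
  have hfib : ∀ τ, b τ ≠ 0 →
      d.natAbs ≤ (Finset.univ.filter fun σ : K.Facet => f.toFun σ.1 = τ.1).card := by
    intro τ hτ
    have h1 : ∑ σ : K.Facet, (if f.toFun σ.1 = τ.1 then f.facetSign σ * a σ else 0) = d * b τ :=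
      congrFun hab τ
    rw [← Finset.sum_filter] at h1
    have h2 : d.natAbs ≤ (d * b τ).natAbs := by
      rw [Int.natAbs_mul]
      exact Nat.le_mul_of_pos_right _ (Int.natAbs_pos.2 hτ)
    refine h2.trans (h1 ▸ (Int.natAbs_sum_le _ _).trans ?_)
    rw [Finset.card_eq_sum_ones]
    refine Finset.sum_le_sum fun σ _ => ?_
    rw [Int.natAbs_mul]
    refine Nat.mul_le_mul (f.natAbs_facetSign_le_one σ) (ha.natAbs_le_one (fun ρ => ?_) σ)
    exact ⟨_, card_facets_le_two hn hK ρ, fun σ => by simp⟩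
  have hdisj : Disjoint (Finset.univ.filter fun x : K.Facet => f.toFun x.1 = σ.1)
      (Finset.univ.filter fun x : K.Facet => f.toFun x.1 = τ.1) :=
    Finset.disjoint_filter.2 fun x _ h1 h2 => hστ (Subtype.ext (h1.symm.trans h2))
  have hcard := Finset.card_le_univ ((Finset.univ.filter fun x : K.Facet => f.toFun x.1 = σ.1) ∪
    (Finset.univ.filter fun x : K.Facet => f.toFun x.1 = τ.1))
  rw [Finset.card_union_of_disjoint hdisj] at hcard
  have := hfib σ hσ
  have := hfib τ hτ
  unfold numFacets
  omega

end SimplicialMap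

end ColoredComplex

/-! ### Facets and cycles of the complex of a colored graph -/

namespace ColoredGraph

variable {n : ℕ}

/-- The simplex `σ(v)` of `K(Γ)`. -/
def facet (Γ : ColoredGraph n) (v : Γ.V) : Γ.toComplex.Facet :=
  ⟨Γ.cell Finset.univ Finset.univ_nonempty v, rfl⟩

theorem facet_bijective (Γ : ColoredGraph n) : Function.Bijective Γ.facet := by
  refine ⟨fun u v h => ?_, fun σ => ?_⟩
  · exact eq_of_component_univ (Γ.cell_eq_cell_iff.1 (congrArg Subtype.val h)).2
  · obtain ⟨A, hA⟩ := σ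
    obtain ⟨v, hv⟩ := Γ.exists_cell_eq A
    refine ⟨v, Subtype.ext ((Γ.cell_eq_cell_iff.2 ⟨?_, (Γ.component _).refl v⟩).trans hv)⟩
    exact hA.symm

theorem numFacets_toComplex (Γ : ColoredGraph n) : Γ.toComplex.numFacets = Fintype.card Γ.V :=
  Fintype.card_congr (Equiv.ofBijective _ Γ.facet_bijective).symm

theorem sum_facet {M : Type*} [AddCommMonoid M] (Γ : ColoredGraph n) (f : Γ.toComplex.Facet → M) :
    ∑ σ, f σ = ∑ v, f (Γ.facet v) :=
  (Γ.facet_bijective.sum_comp f).symm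

theorem chainOfSigns_facet (Γ : ColoredGraph n) (s : Γ.V → ℤ) (v : Γ.V) :
    Γ.chainOfSigns s (Γ.facet v) = s v := by
  unfold chainOfSigns
  congr 1
  exact eq_of_component_univ
    (Γ.cell_eq_cell_iff.1 (Γ.exists_cell_eq (Γ.facet v).1).choose_spec).2

theorem eq_or_eq_nbr_of_component {Γ : ColoredGraph n} {i : Fin (n + 1)} {u v : Γ.V}
    (h : Γ.component {i}ᶜ u v) : v = u ∨ v = Γ.nbr i u := by
  induction h with
  | rel u v e =>
    obtain ⟨j, hj, rfl⟩ := e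
    obtain rfl : j = i := by simpa using hj
    exact Or.inr rfl
  | refl => exact Or.inl rfl
  | symm _ _ _ ih =>
    rcases ih with rfl | rfl
    · exact Or.inl rfl
    · exact Or.inr (Γ.nbr_nbr _ _).symm
  | trans _ _ _ _ _ ih₁ ih₂ =>
    rcases ih₁ with rfl | rfl
    · exact ih₂
    · rcases ih₂ with rfl | rfl
      · exact Or.inr rfl
      · exact Or.inl (Γ.nbr_nbr _ _)

theorem compl_singleton_nonempty (hn : 1 ≤ n) (i : Fin (n + 1)) :
    ({i}ᶜ : Finset (Fin (n + 1))).Nonempty := by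
  rw [← Finset.card_pos, Finset.card_compl, Finset.card_singleton, Fintype.card_fin]
  omega

theorem cell_le_facet_iff (Γ : ColoredGraph n) {i : Fin (n + 1)} (hi : ({i}ᶜ : Finset _).Nonempty)
    (v : Γ.V) (σ : Γ.toComplex.Facet) :
    Γ.cell {i}ᶜ hi v ≤ σ.1 ↔ σ = Γ.facet v ∨ σ = Γ.facet (Γ.nbr i v) := by
  constructor
  · rintro ⟨-, w, hw, hw'⟩
    obtain ⟨u, rfl⟩ := Γ.facet_bijective.2 σ
    have huw : w = u := eq_of_component_univ (Γ.cell_eq_cell_iff.1 hw').2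
    rcases eq_or_eq_nbr_of_component (Γ.cell_eq_cell_iff.1 hw.symm).2 with h | h
    · exact Or.inl (by rw [← huw, h])
    · exact Or.inr (by rw [← huw, h])
  · rintro (rfl | rfl)
    · exact ⟨Finset.subset_univ _, v, rfl, rfl⟩
    · refine ⟨Finset.subset_univ _, Γ.nbr i v, ?_, rfl⟩
      refine Γ.cell_eq_cell_iff.2 ⟨rfl, .symm _ _ (.rel _ _ ⟨i, ?_, rfl⟩)⟩
      exact fun h => Finset.mem_compl.1 h (Finset.mem_singleton_self i)

open Classical in
theorem sum_facets_of_ridge (Γ : ColoredGraph n) {i : Fin (n + 1)}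
    (hi : ({i}ᶜ : Finset _).Nonempty) (v : Γ.V) {A : Γ.toComplex.Face}
    (hA : A = Γ.cell {i}ᶜ hi v) (a : Γ.toComplex.Facet → ℤ) :
    ∑ σ : Γ.toComplex.Facet with A ≤ σ.1, a σ = a (Γ.facet v) + a (Γ.facet (Γ.nbr i v)) := by
  subst hA
  rw [← Finset.sum_pair fun h => Γ.nbr_ne i v (Γ.facet_bijective.1 h).symm]
  refine Finset.sum_congr (Finset.ext fun σ => ?_) fun _ _ => rfl
  rw [Finset.mem_filter, Finset.mem_insert, Finset.mem_singleton]
  exact (and_iff_right (Finset.mem_univ _)).trans (Γ.cell_le_facet_iff hi v σ)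

theorem mem_topHomology_toComplex_iff (hn : 1 ≤ n) {Γ : ColoredGraph n}
    {a : Γ.toComplex.Facet → ℤ} : a ∈ Γ.toComplex.topHomology ↔
      ∀ i v, a (Γ.facet v) + a (Γ.facet (Γ.nbr i v)) = 0 := by
  rw [ColoredComplex.mem_topHomology_iff]
  constructor
  · intro h i v
    have hcard : ({i}ᶜ : Finset (Fin (n + 1))).card = n := by simp [Finset.card_compl]
    rw [← Γ.sum_facets_of_ridge (compl_singleton_nonempty hn i) v rfl]
    exact h ⟨Γ.cell {i}ᶜ (compl_singleton_nonempty hn i) v, hcard⟩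
  · rintro h ⟨A, hA⟩
    obtain ⟨i, hi⟩ : ∃ i, A.colors = {i}ᶜ := by
      have : A.colorsᶜ.card = 1 := by
        rw [Finset.card_compl, Fintype.card_fin, show A.colors.card = n from hA]
        omega
      obtain ⟨i, hi⟩ := Finset.card_eq_one.1 this
      exact ⟨i, by rw [← hi, compl_compl]⟩
    obtain ⟨v, hv⟩ := Γ.exists_cell_eq A
    rw [Γ.sum_facets_of_ridge (compl_singleton_nonempty hn i) v (A := A)
      (hv.symm.trans (Γ.cell_eq_cell_iff.2 ⟨hi, (Γ.component _).refl v⟩))]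
    exact h i v

/-! ### Maps induced by vertex maps -/

namespace VertexMap

variable {Γ Γ' : ColoredGraph n}

/-- The induced map preserves colors, hence the orientations given by the order of the colors. -/
theorem facetSign_toSimplicialMap (g : VertexMap Γ Γ') (σ : Γ.toComplex.Facet) :
    g.toSimplicialMap.facetSign σ = 1 := by
  classical
  have h : ∃ π, g.toSimplicialMap.ActsBy σ π := ⟨1, fun _ _ _ hB => hB⟩
  have h1 : h.choose = 1 := by
    refine Equiv.ext fun i => ?_
    obtain ⟨B, ⟨hB, hBc⟩, -⟩ := Γ.toComplex.existsUnique_face σ.1 {i}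
      (Finset.singleton_nonempty i) (by rw [σ.2]; exact Finset.subset_univ _)
    have h2 := h.choose_spec i B hB hBc
    exact (Finset.singleton_injective (hBc.symm.trans h2)).symm
  rw [ColoredComplex.SimplicialMap.facetSign, dif_pos h, h1]
  simp

open Classical in
theorem pushforward_toSimplicialMap (g : VertexMap Γ Γ') (a : Γ.toComplex.Facet → ℤ) (w : Γ'.V) :
    g.toSimplicialMap.pushforward a (Γ'.facet w) =
      ∑ v, if g.toFun v = w then a (Γ.facet v) else 0 := by
  unfold ColoredComplex.SimplicialMap.pushforward
  rw [sum_facet]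
  refine Finset.sum_congr rfl fun v _ => ?_
  rw [facetSign_toSimplicialMap, one_mul]
  refine if_congr ⟨fun h => ?_, fun h => ?_⟩ rfl rfl
  · exact Γ'.facet_bijective.1 (Subtype.ext h)
  · rw [← h]
    rfl

end VertexMap

/-! ### The self-maps of the sphere -/

section SphereGem

variable {k : ℕ} [NeZero k]

theorem sphereGem_nbr_snd (i : Fin (n + 1)) (v : (sphereGem n k).V) :
    ((sphereGem n k).nbr i v).2 = !v.2 := by
  obtain ⟨j, b⟩ := v
  cases b <;> by_cases h : i = Fin.last n <;> simp [sphereGem, h]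

theorem sphereGemClass_facet (v : (sphereGem n k).V) :
    sphereGemClass n k ((sphereGem n k).facet v) = if v.2 then -1 else 1 :=
  chainOfSigns_facet _ _ v

theorem sum_sphereGem (F : Bool → ℤ) :
    ∑ v : (sphereGem n k).V, F v.2 = k * (F true + F false) := by
  have h := Fintype.sum_prod_type (α₁ := ZMod k) (α₂ := Bool) fun v => F v.2
  simp only [Fintype.sum_bool, Finset.sum_const, Finset.card_univ, ZMod.card, nsmul_eq_mul] at h
  exact h

theorem isFundamentalClass_sphereGemClass (hn : 1 ≤ n) :
    (sphereGem n k).toComplex.IsFundamentalClass (sphereGemClass n k) := by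
  have hmem : sphereGemClass n k ∈ (sphereGem n k).toComplex.topHomology := by
    rw [mem_topHomology_toComplex_iff hn]
    intro i v
    rw [sphereGemClass_facet, sphereGemClass_facet, sphereGem_nbr_snd]
    cases v.2 <;> simp
  refine ⟨fun h => ?_, le_antisymm (fun a ha => ?_) ?_⟩
  · exact one_ne_zero (α := ℤ)
      ((sphereGemClass_facet (n := n) ((0 : ZMod k), false)).symm.trans (congrFun h _))
  · rw [mem_topHomology_toComplex_iff hn] at ha
    have hflip : ∀ j : ZMod k, a ((sphereGem n k).facet (j, true)) =
        - a ((sphereGem n k).facet (j, false)) := by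
      intro j
      have h0 : (0 : Fin (n + 1)) ≠ Fin.last n := by
        rw [Ne, ← Fin.val_inj]
        simp
        omega
      have := ha 0 (j, false)
      simp only [sphereGem, if_neg h0, Bool.not_false] at this
      exact eq_neg_of_add_eq_zero_right this
    have hnext : ∀ j : ZMod k, a ((sphereGem n k).facet (j + 1, false)) =
        - a ((sphereGem n k).facet (j, true)) := by
      intro j
      have := ha (Fin.last n) (j, true)
      simp only [sphereGem, if_true] at this
      exact eq_neg_of_add_eq_zero_right this
    have hconst : ∀ m : ℕ, a ((sphereGem n k).facet ((m : ZMod k), false)) =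
        a ((sphereGem n k).facet (0, false)) := by
      intro m
      induction m with
      | zero => rw [Nat.cast_zero]
      | succ m ih => rw [Nat.cast_succ, hnext, hflip, neg_neg, ih]
    refine Submodule.mem_span_singleton.2 ⟨a ((sphereGem n k).facet (0, false)), funext fun σ => ?_⟩
    obtain ⟨⟨j, b⟩, rfl⟩ := (sphereGem n k).facet_bijective.2 σ
    have hj := hconst j.val
    rw [ZMod.natCast_zmod_val] at hj
    refine (congrArg (a _ * ·) (sphereGemClass_facet (n := n) (j, b))).trans ?_
    cases b
    · exact (mul_one _).trans hj.symm
    · exact (mul_neg_one _).trans ((congrArg Neg.neg hj).symm.trans (hflip j).symm)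
  · rw [Submodule.span_singleton_le_iff_mem]
    exact hmem

theorem isCrystallization_standardCrystallization (hn : 1 ≤ n) :
    (standardCrystallization n).IsCrystallization (plSphere n) := by
  refine ⟨isGem_sphereGem hn 1, ⟨((0 : ZMod 1), false)⟩, fun j u v => ?_⟩
  have hu : u.1 = v.1 := Subsingleton.elim (α := ZMod 1) _ _
  by_cases hj : j = Fin.last n
  · obtain ⟨i, hi⟩ := compl_singleton_nonempty hn (Fin.last n)
    refine component_of_fst_eq (i := i) ?_ (by simpa using hi) hu
    rw [hj]
    simpa using hi
  · refine component_of_axisIndex_eq (by simpa using Ne.symm hj) ?_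
    exact Subsingleton.elim (α := ZMod 1) _ _

/-- The map induced by `foldMap` on the second components of the vertices. -/
def foldBit (d : ℤ) (b : Bool) : Bool := if 0 < d then b else if d < 0 then !b else false

theorem foldBit_of_pos {d : ℤ} (hd : 0 < d) (b : Bool) : foldBit d b = b := if_pos hd

theorem foldBit_of_neg {d : ℤ} (hd : d < 0) (b : Bool) : foldBit d b = !b := by
  rw [foldBit, if_neg (by omega), if_pos hd]

theorem foldBit_zero (b : Bool) : foldBit 0 b = false := rfl

/-- The vertex map that folds `sphereGem n k` onto the standard crystallization with the sign of
`d`, or collapses it to one vertex if `d = 0`. -/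
def foldMap (n k : ℕ) [NeZero k] (d : ℤ) : VertexMap (sphereGem n k) (standardCrystallization n) where
  toFun v := ((0 : ZMod 1), foldBit d v.2)
  map_nbr i v := by
    rcases eq_or_ne d 0 with rfl | h
    · exact Or.inl rfl
    · right
      refine Prod.ext (Subsingleton.elim (α := ZMod 1) _ _)
        (Eq.trans ?_ (sphereGem_nbr_snd i _).symm)
      refine (congrArg (foldBit d) (sphereGem_nbr_snd i v)).trans ?_
      change foldBit d (!v.2) = !foldBit d v.2
      rcases h.lt_or_gt with h | h
      · rw [foldBit_of_neg h, foldBit_of_neg h]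
      · rw [foldBit_of_pos h, foldBit_of_pos h]

theorem hasDegree_foldMap (hn : 1 ≤ n) {d : ℤ} (hk : k = max d.natAbs 1) :
    (foldMap n k d).toSimplicialMap.HasDegree (sphereGemClass n k) (sphereGemClass n 1) d := by
  classical
  refine ⟨isFundamentalClass_sphereGemClass hn, isFundamentalClass_sphereGemClass hn,
    funext fun τ => ?_⟩
  obtain ⟨w, rfl⟩ := (standardCrystallization n).facet_bijective.2 τ
  have hw : ∀ v, (foldMap n k d).toFun v = w ↔ foldBit d v.2 = w.2 := fun v =>
    ⟨fun h => congrArg Prod.snd h, fun h => Prod.ext (Subsingleton.elim (α := ZMod 1) _ _) h⟩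
  rw [VertexMap.pushforward_toSimplicialMap, Pi.smul_apply, sphereGemClass_facet]
  simp only [sphereGemClass_facet, hw]
  rw [sum_sphereGem fun b => if foldBit d b = w.2 then if b then -1 else 1 else 0]
  rcases lt_trichotomy d 0 with h | rfl | h
  · have hkd : (k : ℤ) = -d := by omega
    rw [hkd, foldBit_of_neg h, foldBit_of_neg h]
    cases w.2 <;> simp
  · rw [foldBit_zero, foldBit_zero]
    cases w.2 <;> simp
  · have hkd : (k : ℤ) = d := by omega
    rw [hkd, foldBit_of_pos h, foldBit_of_pos h]
    cases w.2 <;> simp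

theorem card_sphereGem (n k : ℕ) [NeZero k] : Fintype.card (sphereGem n k).V = 2 * k := by
  have : Fintype.card (ZMod k × Bool) = 2 * k := by
    rw [Fintype.card_prod, ZMod.card, Fintype.card_bool, mul_comm]
  exact this

theorem isMinimalOfDegree_foldMap (hn : 1 ≤ n) {d : ℤ} (hk : k = max d.natAbs 1) :
    (foldMap n k d).toSimplicialMap.IsMinimalOfDegree (plSphere n) (plSphere n)
      (sphereGemClass n k) (sphereGemClass n 1) d where
  source := isGem_sphereGem hn k
  target := isGem_sphereGem hn 1
  hasDegree := hasDegree_foldMap hn hk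
  minimal K' L' f' a' b' hK' hL' hf' := by
    rw [numFacets_toComplex, numFacets_toComplex, card_sphereGem, card_sphereGem]
    have h1 := hf'.two_mul_natAbs_le_numFacets hn hK'
    have h2 := hf'.1.two_le_numFacets hn
    have h3 := hf'.2.1.two_le_numFacets hn
    omega

end SphereGem

end ColoredGraph

theorem corollary3p1 (n : ℕ) (hn : 1 ≤ n) (d : ℤ) :
    (ColoredGraph.standardCrystallization n).IsCrystallization (plSphere n) ∧
    (ColoredGraph.sphereGem n (max d.natAbs 1)).IsGem (plSphere n) ∧
    Fintype.card (ColoredGraph.sphereGem n (max d.natAbs 1)).V = 2 * max d.natAbs 1 ∧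
    ∃ g : ColoredGraph.VertexMap (ColoredGraph.sphereGem n (max d.natAbs 1))
        (ColoredGraph.standardCrystallization n),
      (0 < d → ∀ j b, g.toFun (j, b) = (0, b)) ∧
      (d < 0 → ∀ j b, g.toFun (j, b) = (0, !b)) ∧
      (d = 0 → ∀ j b, g.toFun (j, b) = (0, false)) ∧
      g.toSimplicialMap.IsMinimalOfDegree (plSphere n) (plSphere n)
        (ColoredGraph.sphereGemClass n (max d.natAbs 1)) (ColoredGraph.sphereGemClass n 1) d := by
  refine ⟨ColoredGraph.isCrystallization_standardCrystallization hn,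
    ColoredGraph.isGem_sphereGem hn _, ColoredGraph.card_sphereGem n _,
    ColoredGraph.foldMap n _ d, fun h j b => ?_, fun h j b => ?_, fun h j b => ?_,
    ColoredGraph.isMinimalOfDegree_foldMap hn rfl⟩
  · exact congrArg (Prod.mk (0 : ZMod 1)) (ColoredGraph.foldBit_of_pos h b)
  · exact congrArg (Prod.mk (0 : ZMod 1)) (ColoredGraph.foldBit_of_neg h b)
  · exact congrArg (Prod.mk (0 : ZMod 1)) (h ▸ ColoredGraph.foldBit_zero b)
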